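/- **Setting.** Let $d\ge 1$. A prototile is a labelled closed topological disk in $\mathbb R^d$; a tile is a translate of a prototile (carrying its label). A patch is a finite set of tiles overlapping only on their boundaries whose union (its support) is connected; a tiling is a set of tiles overlapping only on their boundaries that covers $\mathbb R^d$. A copy of a patch is a translate of it. A fusion rule $\mathcal R=\{P_n(i): n\ge 0,\ 1\le i\le j_n\}$ (with group $G=\mathbb R^d$ of translations) consists of a finite set of prototiles $P_0(1),\dots,P_0(j_0)$ and, for each $n\ge 1$, finitely many patches $P_n(1),\dots,P_n(j_n)$ (the $n$-supertiles, possibly labelled), each presented as a fusion of $(n-1)$-supertiles, that is, as a connected finite union of translates of $(n-1)$-supertiles that overlap only on their boundaries. The transition matrix entry $M_{n-1,n}(k,l)$ is the number of $(n-1)$-supertiles of type $k$ in (the given presentation of) $P_n(l)$. A patch is admitted if a translate of it is contained in some supertile. $X_{\mathcal R}$ is the set of tilings all of whose patches are admitted, and $X^n_{\mathcal R}$ is the corresponding space when the $n$-supertiles are taken as the basic tiles (so $X^0_{\mathcal R}=X_{\mathcal R}$). These spaces carry the topology of the big ball metric, in which two tilings are $\varepsilon$-close if, after translating each of them by a vector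 of length at most $\varepsilon$, they agree exactly on the ball of radius $1/\varepsilon$ about the origin. $\mathbb R^d$ acts on them by translation. The subdivision map $\sigma_n:X^n_{\mathcal R}\to X^{n-1}_{\mathcal R}$ breaks each $n$-supertile into its $(n-1)$-supertiles. Assume that $X_{\mathcal R}\neq\emptyset$ and that every tiling in $X_{\mathcal R}$ has finite local complexity, i.e. contains only finitely many two-tile patches up to translation. The fusion rule $\mathcal R$ is *strongly primitive* if for every $n\ge 1$ all entries of $M_{n,n+1}$ are strictly positive; *recognizable* if every $\sigma_n$, $n\ge1$, is a homeomorphism; and *van Hove* if for every choice of one $n$-supertile, with support $A_n$, for each $n$, and for every $r\ge 0$, $$\lim_{n\to\infty}\frac{\mathrm{Vol}\big(\{x:\mathrm{dist}(x,\partial A_n)\le r\}\big)}{\mathrm{Vol}(A_n)}=0 .$$ **Corollary.** If $\mathcal R$ is a strongly primitive, van Hove and recognizable fusion rule whose transition matrices $M_{n-1,n}$ $(n\ge 1)$ have uniformly bounded entries, then $(X_{\mathcal R},\mathbb R^d)$ is uniquely ergodic: it has exactly one ergodic Borel probability measure, and this is its only translation-invariant Borel probability measure. -/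

import Mathlib

open MeasureTheory Filter Topology

namespace FusionTiling

/-- Euclidean space of dimension `d`. -/
abbrev E (d : ℕ) : Type := EuclideanSpace ℝ (Fin d)

/-- A closed topological disk in `ℝ^d`: a set homeomorphic to the closed unit ball, the unit sphere
corresponding to the boundary of the set (the latter is automatic, by invariance of domain). -/
def IsClosedDisk {d : ℕ} (S : Set (E d)) : Prop :=
  ∃ e : Metric.closedBall (0 : E d) 1 ≃ₜ S, ∀ x, (e x : E d) ∈ frontier S ↔ ‖(x : E d)‖ = 1

/-- Two sets overlap only on their boundaries. -/
def OverlapOnBoundary {d : ℕ} (A B : Set (E d)) : Prop :=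
  A ∩ B ⊆ frontier A ∩ frontier B

section Tiles

/-! A family `S : ι → Set (E d)` gives the supports of the basic building blocks; the index plays
the role of the label. A tile is a translate of a building block, recorded as its label together
with the translation vector. Patches and tilings are sets of tiles. -/

variable {ι : Type} {d : ℕ}

/-- The subset of `ℝ^d` occupied by a tile. -/
def tileSupport (S : ι → Set (E d)) (t : ι × E d) : Set (E d) :=
  (fun x => t.2 + x) '' S t.1

/-- The subset of `ℝ^d` covered by a collection of tiles. -/
def patchSupport (S : ι → Set (E d)) (Q : Set (ι × E d)) : Set (E d) :=
  ⋃ t ∈ Q, tileSupport S t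

/-- Translation of a collection of tiles by `v`; labels are carried along. -/
def translate (v : E d) (Q : Set (ι × E d)) : Set (ι × E d) :=
  (fun t => (t.1, v + t.2)) '' Q

/-- Tiles that overlap only on their boundaries. -/
def NonOverlapping (S : ι → Set (E d)) (Q : Set (ι × E d)) : Prop :=
  Q.Pairwise fun s t => OverlapOnBoundary (tileSupport S s) (tileSupport S t)

/-- A patch: a connected, finite union of tiles that only overlap on their boundaries. -/
structure IsPatch (S : ι → Set (E d)) (Q : Set (ι × E d)) : Prop where
  finite : Q.Finite
  nonOverlapping : NonOverlapping S Q
  connected : IsConnected (patchSupport S Q)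

/-- A tiling of `ℝ^d`. -/
structure IsTiling (S : ι → Set (E d)) (T : Set (ι × E d)) : Prop where
  covers : patchSupport S T = Set.univ
  nonOverlapping : NonOverlapping S T

/-- Finite local complexity: only finitely many connected two-tile patches up to translation. -/
def IsFLC (S : ι → Set (E d)) (T : Set (ι × E d)) : Prop :=
  ∃ F : Set (Set (ι × E d)), F.Finite ∧
    ∀ s ∈ T, ∀ t ∈ T, s ≠ t → IsPatch S {s, t} → ∃ v : E d, translate v {s, t} ∈ F

/-- Two collections of tiles exactly agree on the closed ball of radius `r` about the origin. -/
def AgreeOnBall (S : ι → Set (E d)) (r : ℝ) (T T' : Set (ι × E d)) : Prop :=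
  ∀ t, (tileSupport S t ∩ Metric.closedBall 0 r).Nonempty → (t ∈ T ↔ t ∈ T')

/-- `ε`-closeness in the big ball metric: after translations of size at most `ε` the two tilings
exactly agree on the ball of radius `1 / ε` about the origin. -/
def Close (S : ι → Set (E d)) (ε : ℝ) (T T' : Set (ι × E d)) : Prop :=
  ∃ u w : E d, ‖u‖ ≤ ε ∧ ‖w‖ ≤ ε ∧ AgreeOnBall S (1 / ε) (translate u T) (translate w T')

theorem Close.mono {S : ι → Set (E d)} {ε ε' : ℝ} (hε : 0 < ε) (h : ε ≤ ε')
    {T T' : Set (ι × E d)} (hc : Close S ε T T') : Close S ε' T T' := by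
  obtain ⟨u, w, hu, hw, ha⟩ := hc
  refine ⟨u, w, hu.trans h, hw.trans h, fun t ht => ha t (ht.mono ?_)⟩
  exact Set.inter_subset_inter_right _
    (Metric.closedBall_subset_closedBall (one_div_le_one_div_of_le hε h))

theorem translate_zero (Q : Set (ι × E d)) : translate 0 Q = Q := by
  simp [translate]

theorem translate_translate (v w : E d) (Q : Set (ι × E d)) :
    translate v (translate w Q) = translate (v + w) Q := by
  simp only [translate, Set.image_image, add_assoc]

theorem translate_mono {v : E d} {Q Q' : Set (ι × E d)} (h : Q ⊆ Q') :
    translate v Q ⊆ translate v Q' := Set.image_mono h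

theorem tileSupport_translate (S : ι → Set (E d)) (v : E d) (t : ι × E d) :
    tileSupport S (t.1, v + t.2) = Homeomorph.addLeft v '' tileSupport S t := by
  simp only [tileSupport, Set.image_image, Homeomorph.coe_addLeft, add_assoc]

theorem patchSupport_translate (S : ι → Set (E d)) (v : E d) (Q : Set (ι × E d)) :
    patchSupport S (translate v Q) = Homeomorph.addLeft v '' patchSupport S Q := by
  simp only [patchSupport, translate, Set.biUnion_image, Set.image_iUnion, tileSupport_translate]

theorem NonOverlapping.translate {S : ι → Set (E d)} {Q : Set (ι × E d)}
    (h : NonOverlapping S Q) (v : E d) : NonOverlapping S (translate v Q) := by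
  rintro _ ⟨s, hs, rfl⟩ _ ⟨t, ht, rfl⟩ hst
  have hne : s ≠ t := fun h => hst (by rw [h])
  simp only [OverlapOnBoundary, tileSupport_translate, ← Homeomorph.image_frontier]
  rw [← Set.image_inter (Homeomorph.addLeft v).injective,
    ← Set.image_inter (Homeomorph.addLeft v).injective]
  exact Set.image_mono (h hs ht hne)

theorem IsPatch.translate {S : ι → Set (E d)} {Q : Set (ι × E d)}
    (h : IsPatch S Q) (v : E d) : IsPatch S (translate v Q) where
  finite := h.finite.image _
  nonOverlapping := h.nonOverlapping.translate v
  connected := by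
    rw [patchSupport_translate]
    exact h.connected.image _ (Homeomorph.addLeft v).continuous.continuousOn

theorem IsTiling.translate {S : ι → Set (E d)} {T : Set (ι × E d)}
    (h : IsTiling S T) (v : E d) : IsTiling S (translate v T) where
  covers := by
    rw [patchSupport_translate, h.covers, Set.image_univ, (Homeomorph.addLeft v).range_coe]
  nonOverlapping := h.nonOverlapping.translate v

end Tiles

/-- A fusion rule in `ℝ^d` for the group `ℝ^d` of translations. There are `j n` types of
`n`-supertiles; the `0`-supertiles are the prototiles. The `(n+1)`-supertile of type `l` is the
patch obtained as the (preferred) fusion of the translated `n`-supertiles listed in `fusion n l`. -/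
structure FusionRule (d : ℕ) where
  j : ℕ → ℕ
  support : ∀ n, Fin (j n) → Set (E d)
  fusion : ∀ n, Fin (j (n + 1)) → Finset (Fin (j n) × E d)
  prototile_disk : ∀ k, IsClosedDisk (support 0 k)
  support_succ : ∀ n l, support (n + 1) l = patchSupport (support n) (fusion n l)
  fusion_patch : ∀ n l, IsPatch (support n) (fusion n l)

namespace FusionRule

variable {d : ℕ} (R : FusionRule d)

/-- The transition matrix from level `n` to level `n + 1`: its `(k, l)` entry is the number of
`n`-supertiles of type `k` in the `(n+1)`-supertile of type `l`. -/
def transition (n : ℕ) : Matrix (Fin (R.j n)) (Fin (R.j (n + 1))) ℕ :=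
  fun k l => ((R.fusion n l).filter fun t => t.1 = k).card

/-- Subdivision of a collection of `(n+1)`-supertiles into `n`-supertiles. -/
def subdivide (n : ℕ) (T : Set (Fin (R.j (n + 1)) × E d)) : Set (Fin (R.j n) × E d) :=
  ⋃ t ∈ T, translate t.2 (R.fusion n t.1)

/-- The `(n+m)`-supertile of type `l` as a patch of `n`-supertiles. -/
def supertile (n : ℕ) : ∀ m, Fin (R.j (n + m)) → Set (Fin (R.j n) × E d)
  | 0, l => {(l, 0)}
  | m + 1, l => ⋃ t ∈ R.fusion (n + m) l, translate t.2 (supertile n m t.1)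

/-- A patch of `n`-supertiles is admitted if a copy of it is found inside some supertile. -/
def Admitted (n : ℕ) (Q : Set (Fin (R.j n) × E d)) : Prop :=
  ∃ (m : ℕ) (l : Fin (R.j (n + m))) (v : E d), translate v Q ⊆ R.supertile n m l

/-- A fusion tiling in which the `n`-supertiles are considered the smallest building blocks:
every patch contained in it is admitted. -/
structure IsFusionTiling (n : ℕ) (T : Set (Fin (R.j n) × E d)) : Prop where
  isTiling : IsTiling (R.support n) T
  admitted : ∀ Q ⊆ T, IsPatch (R.support n) Q → R.Admitted n Q

/-- The space `X^n` of fusion tilings with the `n`-supertiles as building blocks. -/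
def TilingSpace (n : ℕ) : Type :=
  {T : Set (Fin (R.j n) × E d) // R.IsFusionTiling n T}

/-- The space `X` of all fusion tilings. -/
abbrev X : Type := R.TilingSpace 0

theorem IsFusionTiling.translate {R : FusionRule d} {n : ℕ} {T : Set (Fin (R.j n) × E d)}
    (h : R.IsFusionTiling n T) (v : E d) : R.IsFusionTiling n (translate v T) where
  isTiling := h.isTiling.translate v
  admitted Q hQ hp := by
    have hsub : FusionTiling.translate (-v) Q ⊆ T := by
      have := translate_mono (v := -v) hQ
      rwa [translate_translate, neg_add_cancel, translate_zero] at this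
    obtain ⟨m, l, w, hw⟩ := h.admitted _ hsub (hp.translate _)
    exact ⟨m, l, w + -v, by rwa [translate_translate] at hw⟩

/-- The topology of the big ball metric. -/
instance (n : ℕ) : TopologicalSpace (R.TilingSpace n) where
  IsOpen U := ∀ T ∈ U, ∃ ε > 0, ∀ T', Close (R.support n) ε T.1 T'.1 → T' ∈ U
  isOpen_univ _ _ := ⟨1, one_pos, fun _ _ => trivial⟩
  isOpen_inter U V hU hV T hT := by
    obtain ⟨ε, hε, h⟩ := hU T hT.1
    obtain ⟨δ, hδ, h'⟩ := hV T hT.2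
    exact ⟨min ε δ, lt_min hε hδ, fun T' hc =>
      ⟨h T' (hc.mono (lt_min hε hδ) (min_le_left _ _)),
        h' T' (hc.mono (lt_min hε hδ) (min_le_right _ _))⟩⟩
  isOpen_sUnion s hs T hT := by
    obtain ⟨U, hU, hTU⟩ := hT
    obtain ⟨ε, hε, h⟩ := hs U hU T hTU
    exact ⟨ε, hε, fun T' hc => ⟨U, hU, h T' hc⟩⟩

instance (n : ℕ) : MeasurableSpace (R.TilingSpace n) := borel _

instance (n : ℕ) : BorelSpace (R.TilingSpace n) := ⟨rfl⟩

/-- The action of `ℝ^d` by translations. -/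
instance (n : ℕ) : AddAction (E d) (R.TilingSpace n) where
  vadd v T := ⟨translate v T.1, T.2.translate v⟩
  zero_vadd T := Subtype.ext (translate_zero T.1)
  add_vadd v w T := Subtype.ext (translate_translate v w T.1).symm

/-- Recognizability: for each `n`, subdivision of `(n+1)`-supertiles is a homeomorphism from
`X^(n+1)` onto `X^n`. -/
def Recognizable : Prop :=
  ∀ n, ∃ h : R.TilingSpace (n + 1) ≃ₜ R.TilingSpace n, ∀ T, (h T).1 = R.subdivide n T.1

/-- Strong primitivity: for every `n ≥ 1`, each `(n+1)`-supertile contains at least one copy of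
every `n`-supertile. -/
def StronglyPrimitive : Prop :=
  ∀ n, 1 ≤ n → ∀ k l, 0 < R.transition n k l

end FusionRule

/-- A van Hove sequence of subsets of `ℝ^d`. -/
def IsVanHove {d : ℕ} (A : ℕ → Set (E d)) : Prop :=
  ∀ r : ℝ, 0 ≤ r → Tendsto (fun n =>
    (volume (Metric.cthickening r (frontier (A n)))).toReal / (volume (A n)).toReal) atTop (𝓝 0)

/-- A van Hove fusion rule: every sequence consisting of the support of one `n`-supertile for each
`n` is a van Hove sequence. -/
def FusionRule.VanHove {d : ℕ} (R : FusionRule d) : Prop :=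
  ∀ c : ∀ n, Fin (R.j n), IsVanHove fun n => R.support n (c n)

/-- Unique ergodicity of an action of `G` on `X`: there is exactly one ergodic probability measure,
and it is the only invariant probability measure whatsoever. -/
def UniquelyErgodic (G X : Type) [AddGroup G] [AddAction G X] [MeasurableSpace X] : Prop :=
  ∃ μ : Measure X, IsProbabilityMeasure μ ∧ ErgodicVAdd G X μ ∧
    ∀ ν : Measure X, IsProbabilityMeasure ν → VAddInvariantMeasure G X ν → ν = μ

end FusionTiling

/-!
The proof shows that the averages of a continuous function `f` over large balls converge, uniformly
in the tiling, to a constant; unique ergodicity follows from this.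

Compactness. The topology of the tiling space comes from a uniform structure with entourages given
by `Close`. By recognizability every fusion tiling carries a hierarchy of tilings by supertiles
(`IsHierarchy`), and by strong primitivity every supertile of positive level occurs in every tiling.
Hence the finite list of two-tile patches of one tiling serves all of them, the tiles near the
origin are confined to a finite set after a normalization (`exists_finite_tilesMeeting`), and the
tiling space is compact (`compactSpace`). In particular `f` is uniformly continuous.

Averages over supertiles. Near a point deep inside an `N`-supertile the tiling is determined by the
type of the supertile. By the van Hove property most points are deep inside for large `N`, so the
average of `f` over an `N`-supertile depends, up to a small error, only on its type
(`eventually_exists_hasAverages`). The average over an `(N+1)`-supertile of type `l` is nearly the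
average of the values for the `N`-supertiles with weights proportional to `M(k,l) Vol(k)`, where
`M` is the transition matrix. Since `1 ≤ M(k,l) ≤ K`, each of these probability vectors dominates
`1/K` times the one proportional to `Vol(k)`, so by Doeblin's argument
(`abs_sum_sub_sum_le_of_minorization`) the oscillation of the averages shrinks by the factor
`1 - 1/K` from one level to the next, up to the small error (`oscillation_succ_le`). The number of
supertile types need not be bounded. The boundaries of tiles may have positive volume; at high
levels the van Hove property makes them negligible.

Conclusion. A ball is nearly a union of supertiles of high level, so the ball averages of `f`
converge uniformly to a constant `c` (`exists_tendstoUniformly_ballAverage`). By Fubini's theorem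
every invariant probability measure gives `f` the integral `c`, so there is at most one. A weak
limit of the empirical measures of an orbit exists by compactness, gives `f` the integral `c` as
well, and is therefore invariant. A unique invariant probability measure is ergodic.
-/

namespace FusionTiling

/-! ### Supports of tiles -/

section Geometry

variable {ι : Type} {d : ℕ} {S : ι → Set (E d)}

theorem IsClosedDisk.isCompact {A : Set (E d)} (h : IsClosedDisk A) : IsCompact A := by
  obtain ⟨e, -⟩ := h
  have : CompactSpace (Metric.closedBall (0 : E d) 1) :=
    isCompact_iff_compactSpace.mp (isCompact_closedBall _ _)
  exact isCompact_iff_compactSpace.mpr e.compactSpace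

theorem IsClosedDisk.isConnected {A : Set (E d)} (h : IsClosedDisk A) : IsConnected A := by
  obtain ⟨e, -⟩ := h
  have h1 : IsConnected (Metric.closedBall (0 : E d) 1) :=
    (convex_closedBall _ _).isConnected ⟨0, by simp⟩
  have : ConnectedSpace (Metric.closedBall (0 : E d) 1) := isConnected_iff_connectedSpace.mp h1
  have h2 := isConnected_range (f := fun x => (e x : E d)) (by fun_prop)
  convert h2
  ext x
  exact ⟨fun hx => ⟨e.symm ⟨x, hx⟩, by simp⟩, by rintro ⟨y, rfl⟩; exact (e y).2⟩

theorem IsClosedDisk.interior_nonempty {A : Set (E d)} (h : IsClosedDisk A) :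
    (interior A).Nonempty := by
  have hA := h.isCompact.isClosed
  obtain ⟨e, he⟩ := h
  refine ⟨e ⟨0, by simp⟩, ?_⟩
  by_contra hx
  have : (e ⟨0, by simp⟩ : E d) ∈ frontier A := by
    rw [hA.frontier_eq]; exact ⟨(e _).2, hx⟩
  simpa using (he _).1 this

theorem tileSupport_eq_image (t : ι × E d) :
    tileSupport S t = Homeomorph.addLeft t.2 '' S t.1 := rfl

theorem mem_tileSupport {t : ι × E d} {x : E d} : x ∈ tileSupport S t ↔ x - t.2 ∈ S t.1 := by
  constructor
  · rintro ⟨y, hy, rfl⟩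
    simpa using hy
  · intro h
    exact ⟨_, h, by simp⟩

theorem mem_translate {v : E d} {Q : Set (ι × E d)} {t : ι × E d} :
    t ∈ translate v Q ↔ (t.1, t.2 - v) ∈ Q := by
  constructor
  · rintro ⟨s, hs, rfl⟩
    simpa using hs
  · intro h
    exact ⟨_, h, by simp⟩

theorem isCompact_tileSupport (hc : ∀ k, IsCompact (S k)) (t : ι × E d) :
    IsCompact (tileSupport S t) :=
  (hc t.1).image (Homeomorph.addLeft t.2).continuous

theorem interior_tileSupport (t : ι × E d) :
    interior (tileSupport S t) = Homeomorph.addLeft t.2 '' interior (S t.1) := by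
  rw [tileSupport_eq_image, Homeomorph.image_interior]

theorem frontier_tileSupport (t : ι × E d) :
    frontier (tileSupport S t) = Homeomorph.addLeft t.2 '' frontier (S t.1) := by
  rw [tileSupport_eq_image, Homeomorph.image_frontier]

theorem interior_tileSupport_nonempty (hi : ∀ k, (interior (S k)).Nonempty) (t : ι × E d) :
    (interior (tileSupport S t)).Nonempty := by
  rw [interior_tileSupport]
  exact (hi _).image _

theorem volume_addLeft_image (v : E d) (A : Set (E d)) :
    volume (Homeomorph.addLeft v '' A) = volume A := by
  simp

/-- Two sets that overlap only on their boundaries have disjoint interiors; indeed the interior of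
the one misses all of the other. -/
theorem OverlapOnBoundary.disjoint_interior {A B : Set (E d)} (h : OverlapOnBoundary A B) :
    Disjoint (interior A) B := by
  rw [Set.disjoint_left]
  intro x hA hB
  exact (h ⟨interior_subset hA, hB⟩).1.2 hA

theorem NonOverlapping.eq_of_mem {Q : Set (ι × E d)} (h : NonOverlapping S Q) {s t : ι × E d}
    (hs : s ∈ Q) (ht : t ∈ Q) {x : E d} (hxs : x ∈ interior (tileSupport S s))
    (hxt : x ∈ tileSupport S t) : s = t := by
  by_contra hst
  exact Set.disjoint_left.1 (h hs ht hst).disjoint_interior hxs hxt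

/-- The tiles of a finite family of compact prototiles lie uniformly close to their positions. -/
theorem exists_bound [Finite ι] (hc : ∀ k, IsCompact (S k)) :
    ∃ D : ℝ, 0 ≤ D ∧ ∀ (t : ι × E d), ∀ x ∈ tileSupport S t, ‖x - t.2‖ ≤ D := by
  have : Bornology.IsBounded (⋃ k, S k) := Bornology.isBounded_iUnion.2 fun k => (hc k).isBounded
  obtain ⟨D, hD⟩ := this.exists_norm_le
  refine ⟨max D 0, le_max_right _ _, fun t x hx => (hD _ ?_).trans (le_max_left _ _)⟩
  exact Set.mem_iUnion.2 ⟨_, mem_tileSupport.1 hx⟩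

/-- The tiles of `T` that meet the closed ball of radius `r` about the origin. -/
def tilesMeeting (S : ι → Set (E d)) (r : ℝ) (T : Set (ι × E d)) : Set (ι × E d) :=
  {t ∈ T | (tileSupport S t ∩ Metric.closedBall 0 r).Nonempty}

theorem NonOverlapping.mono {Q Q' : Set (ι × E d)} (h : NonOverlapping S Q) (hQ : Q' ⊆ Q) :
    NonOverlapping S Q' := Set.Pairwise.mono hQ h

/-- A ball meets only boundedly many non-overlapping tiles: their interiors are disjoint, have
volume bounded below, and lie in a slightly larger ball. -/
theorem exists_card_bound [Finite ι] (hc : ∀ k, IsCompact (S k))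
    (hi : ∀ k, (interior (S k)).Nonempty) (r : ℝ) :
    ∃ N : ℕ, ∀ T, NonOverlapping S T → (tilesMeeting S r T).Finite ∧
      (tilesMeeting S r T).ncard ≤ N := by
  classical
  have := Fintype.ofFinite ι
  obtain ⟨D, hD0, hD⟩ := exists_bound hc
  rcases isEmpty_or_nonempty ι with hE | hN
  · exact ⟨0, fun T _ => by simp [Set.eq_empty_of_isEmpty]⟩
  obtain ⟨k₀, hk₀⟩ := Finite.exists_min fun k => volume (interior (S k))
  have hpos : 0 < volume (interior (S k₀)) := isOpen_interior.measure_pos _ (hi k₀)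
  have hfin : volume (interior (S k₀)) < ⊤ :=
    (measure_mono interior_subset).trans_lt (hc k₀).measure_lt_top
  set B := Metric.closedBall (0 : E d) (r + 2 * D)
  have hB : volume B < ⊤ := (isCompact_closedBall _ _).measure_lt_top
  obtain ⟨N, hN⟩ := ENNReal.exists_nat_mul_gt hpos.ne' hB.ne
  have key : ∀ T, NonOverlapping S T → ∀ F : Finset (ι × E d), ↑F ⊆ tilesMeeting S r T →
      F.card ≤ N := by
    intro T hT F hF
    have h1 : volume (⋃ t ∈ F, interior (tileSupport S t)) =
        ∑ t ∈ F, volume (interior (tileSupport S t)) := by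
      refine measure_biUnion_finset (fun s hs t ht hst => ?_) fun t _ =>
        isOpen_interior.measurableSet
      exact (hT (hF hs).1 (hF ht).1 hst).disjoint_interior.mono_right interior_subset
    have h2 : (⋃ t ∈ F, interior (tileSupport S t)) ⊆ B := by
      refine Set.iUnion₂_subset fun t ht x hx => ?_
      obtain ⟨y, hyt, hy⟩ := (hF ht).2
      have e1 := hD t x (interior_subset hx)
      have e2 := hD t y hyt
      rw [mem_closedBall_zero_iff] at hy ⊢
      have : x = y + (x - t.2) - (y - t.2) := by abel
      rw [this]
      calc _ ≤ ‖y + (x - t.2)‖ + ‖y - t.2‖ := norm_sub_le _ _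
        _ ≤ ‖y‖ + ‖x - t.2‖ + ‖y - t.2‖ := by gcongr; exact norm_add_le _ _
        _ ≤ _ := by linarith
    have h3 : F.card * volume (interior (S k₀)) ≤ volume B := by
      calc _ = ∑ t ∈ F, volume (interior (S k₀)) := by simp
        _ ≤ ∑ t ∈ F, volume (interior (tileSupport S t)) := by
          refine Finset.sum_le_sum fun t _ => ?_
          rw [interior_tileSupport, volume_addLeft_image]
          exact hk₀ _
        _ ≤ _ := by rw [← h1]; exact measure_mono h2
    have h4 := h3.trans_lt hN
    by_contra hlt
    push Not at hlt
    refine absurd h4 (not_lt.2 ?_)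
    gcongr
  refine ⟨N, fun T hT => ?_⟩
  have hfinite : (tilesMeeting S r T).Finite := by
    by_contra hinf
    obtain ⟨F, hF, hcard⟩ := Set.Infinite.exists_subset_card_eq hinf (N + 1)
    have := key T hT F hF
    omega
  refine ⟨hfinite, ?_⟩
  rw [Set.ncard_eq_toFinset_card _ hfinite]
  exact key T hT _ (by simp)

theorem tilesMeeting_finite [Finite ι] (hc : ∀ k, IsCompact (S k))
    (hi : ∀ k, (interior (S k)).Nonempty) {T : Set (ι × E d)} (hT : NonOverlapping S T) (r : ℝ) :
    (tilesMeeting S r T).Finite :=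
  ((exists_card_bound hc hi r).choose_spec T hT).1

end Geometry

namespace FusionRule

variable {d : ℕ} (R : FusionRule d)

theorem fusion_nonempty (n : ℕ) (l : Fin (R.j (n + 1))) : (R.fusion n l).Nonempty := by
  obtain ⟨x, hx⟩ := (R.fusion_patch n l).connected.nonempty
  simp only [patchSupport, Set.mem_iUnion] at hx
  obtain ⟨t, ht, -⟩ := hx
  exact ⟨t, ht⟩

theorem isCompact_support : ∀ n k, IsCompact (R.support n k)
  | 0, k => (R.prototile_disk k).isCompact
  | n + 1, l => by
    rw [R.support_succ]
    exact (R.fusion_patch n l).finite.isCompact_biUnion fun t _ =>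
      isCompact_tileSupport (isCompact_support n) t

theorem interior_support_nonempty : ∀ n k, (interior (R.support n k)).Nonempty
  | 0, k => (R.prototile_disk k).interior_nonempty
  | n + 1, l => by
    obtain ⟨t, ht⟩ := R.fusion_nonempty n l
    rw [R.support_succ]
    refine (interior_tileSupport_nonempty (interior_support_nonempty n) t).mono ?_
    exact interior_mono (Set.subset_biUnion_of_mem (u := tileSupport (R.support n)) ht)

theorem volume_support_pos (n : ℕ) (k : Fin (R.j n)) : 0 < volume.real (R.support n k) := by
  refine ENNReal.toReal_pos ?_ (R.isCompact_support n k).measure_lt_top.ne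
  exact (Measure.measure_pos_of_nonempty_interior _ (R.interior_support_nonempty n k)).ne'

end FusionRule

/-! ### The topology of the tiling space -/

section Agreement

variable {ι : Type} {d : ℕ} {S : ι → Set (E d)}

theorem AgreeOnBall.symm {r : ℝ} {T T' : Set (ι × E d)} (h : AgreeOnBall S r T T') :
    AgreeOnBall S r T' T := fun t ht => (h t ht).symm

theorem AgreeOnBall.trans {r : ℝ} {T T' T'' : Set (ι × E d)} (h : AgreeOnBall S r T T')
    (h' : AgreeOnBall S r T' T'') : AgreeOnBall S r T T'' :=
  fun t ht => (h t ht).trans (h' t ht)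

theorem AgreeOnBall.translate {r r' : ℝ} {T T' : Set (ι × E d)} (h : AgreeOnBall S r T T')
    {v : E d} (hr : r' + ‖v‖ ≤ r) :
    AgreeOnBall S r' (translate v T) (translate v T') := by
  rintro ⟨k, p⟩ ⟨x, hx, hxr⟩
  rw [mem_translate, mem_translate]
  refine h _ ⟨x - v, ?_, ?_⟩
  · simpa [mem_tileSupport] using hx
  · rw [mem_closedBall_zero_iff] at hxr ⊢
    linarith [norm_sub_le x v]

theorem Close.refl {ε : ℝ} (hε : 0 ≤ ε) (T : Set (ι × E d)) : Close S ε T T :=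
  ⟨0, 0, by simpa, by simpa, fun _ _ => Iff.rfl⟩

theorem Close.symm {ε : ℝ} {T T' : Set (ι × E d)} (h : Close S ε T T') : Close S ε T' T := by
  obtain ⟨u, w, hu, hw, h⟩ := h
  exact ⟨w, u, hw, hu, h.symm⟩

/-- The weak triangle inequality for `Close`: translating by at most `ε` shrinks the ball of radius
`1 / ε` on which two tilings agree by at most `ε`, and `1 / (2 * ε) + ε ≤ 1 / ε`. -/
theorem Close.trans {ε : ℝ} (hε : 0 < ε) (hε' : ε ≤ 1 / 2) {T T' T'' : Set (ι × E d)}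
    (h : Close S ε T T') (h' : Close S ε T' T'') : Close S (2 * ε) T T'' := by
  obtain ⟨u, w, hu, hw, h⟩ := h
  obtain ⟨u', w', hu', hw', h'⟩ := h'
  have hr : 1 / (2 * ε) + ε ≤ 1 / ε := by
    have : ε * ε ≤ 1 / 2 := by nlinarith
    rw [div_add' _ _ _ (by positivity), div_le_div_iff₀ (by positivity) hε]
    nlinarith
  refine ⟨u' + u, w + w', ?_, ?_, ?_⟩
  · linarith [norm_add_le u' u]
  · linarith [norm_add_le w w']
  · have h1 := h.translate (v := u') (r' := 1 / (2 * ε)) (by linarith)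
    have h2 := h'.translate (v := w) (r' := 1 / (2 * ε)) (by linarith)
    rw [translate_translate, translate_translate] at h1 h2
    rw [add_comm w u'] at h2
    exact h1.trans h2

/-- Tilings that are arbitrarily close coincide: near a given point a tiling has only finitely many
tiles, so tiles that can be moved into it by arbitrarily small vectors already belong to it. -/
theorem subset_of_forall_close [Finite ι] (hc : ∀ k, IsCompact (S k))
    (hi : ∀ k, (interior (S k)).Nonempty) {T T' : Set (ι × E d)} (hT' : NonOverlapping S T')
    (h : ∀ ε > 0, Close S ε T T') : T ⊆ T' := by
  rintro ⟨k, p⟩ ht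
  obtain ⟨x, hx⟩ := (interior_tileSupport_nonempty hi (k, p)).mono interior_subset
  have hfin := tilesMeeting_finite hc hi hT' (‖x‖ + 2)
  set P : Set (E d) := {q | (k, q) ∈ tilesMeeting S (‖x‖ + 2) T'} with hP
  have hPfin : P.Finite :=
    hfin.preimage (f := fun q => (k, q)) (by intro a _ b _ hab; simpa using hab)
  suffices p ∈ P from this.1
  rw [← hPfin.isClosed.closure_eq, Metric.mem_closure_iff]
  intro ε hε
  -- At scale `δ` the two tilings agree on a ball that contains the point `x` after the shift, and
  -- the tile is moved by at most `2 * δ < ε`.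
  set δ := min (ε / 3) (1 / (‖x‖ + 1)) with hδ
  have hδ0 : 0 < δ := by positivity
  have hδε : δ ≤ ε / 3 := min_le_left _ _
  have hδx : δ ≤ 1 / (‖x‖ + 1) := min_le_right _ _
  have hδ1 : δ ≤ 1 := hδx.trans (by rw [div_le_one (by positivity)]; linarith [norm_nonneg x])
  obtain ⟨u, w, hu, hw, hag⟩ := h δ hδ0
  have hrad : ‖x‖ + 1 ≤ 1 / δ := by
    rw [le_div_iff₀ hδ0]; rw [le_div_iff₀ (by positivity)] at hδx; linarith
  have hmem := (hag (k, u + p) ⟨u + x, by simpa [mem_tileSupport] using hx, ?_⟩).1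
    (by simpa [mem_translate] using ht)
  · rw [mem_translate] at hmem
    refine ⟨u + p - w, ⟨hmem, u + x - w, ?_, ?_⟩, ?_⟩
    · have : u + x - w - (u + p - w) = x - p := by abel
      simpa [mem_tileSupport, this] using hx
    · rw [mem_closedBall_zero_iff]
      linarith [norm_sub_le (u + x) w, norm_add_le u x]
    · have : p - (u + p - w) = w - u := by abel
      rw [dist_eq_norm, this]
      linarith [norm_sub_le w u]
  · rw [mem_closedBall_zero_iff]
    linarith [norm_add_le u x]

end Agreement

namespace FusionRule

variable {d : ℕ} (R : FusionRule d)

/-- The uniform structure whose entourages are given by `Close`. -/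
def uniformCore (n : ℕ) : UniformSpace.Core (R.TilingSpace n) :=
  .mkOfBasis
    { sets := {V | ∃ ε : ℝ, 0 < ε ∧ V = {p | Close (R.support n) ε p.1.1 p.2.1}}
      nonempty := ⟨_, 1, one_pos, rfl⟩
      inter_sets := by
        rintro _ _ ⟨ε, hε, rfl⟩ ⟨δ, hδ, rfl⟩
        refine ⟨_, ⟨min ε δ, lt_min hε hδ, rfl⟩, fun p hp => ⟨?_, ?_⟩⟩
        · exact Close.mono (lt_min hε hδ) (min_le_left _ _) hp
        · exact Close.mono (lt_min hε hδ) (min_le_right _ _) hp }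
    (by rintro _ ⟨ε, hε, rfl⟩ T; exact Close.refl hε.le _)
    (by rintro _ ⟨ε, hε, rfl⟩; exact ⟨_, ⟨ε, hε, rfl⟩, fun p hp => Close.symm hp⟩)
    (by
      rintro _ ⟨ε, hε, rfl⟩
      refine ⟨_, ⟨min (ε / 2) (1 / 2), by positivity, rfl⟩, ?_⟩
      rintro ⟨T, T''⟩ ⟨T', h, h'⟩
      refine Close.mono (by positivity) ?_ (Close.trans (by positivity) (min_le_right _ _) h h')
      linarith [min_le_left (ε / 2) (1 / 2)])

theorem uniformCore_hasBasis (n : ℕ) : (R.uniformCore n).uniformity.HasBasis (fun ε : ℝ => 0 < ε)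
    fun ε => {p | Close (R.support n) ε p.1.1 p.2.1} := by
  refine ⟨fun V => (FilterBasis.mem_filter_iff _).trans ?_⟩
  constructor
  · rintro ⟨_, ⟨ε, hε, rfl⟩, h⟩
    exact ⟨ε, hε, h⟩
  · rintro ⟨ε, hε, h⟩
    exact ⟨_, ⟨ε, hε, rfl⟩, h⟩

theorem topology_eq (n : ℕ) :
    (inferInstance : TopologicalSpace (R.TilingSpace n)) =
      (R.uniformCore n).toTopologicalSpace := by
  refine TopologicalSpace.ext_iff.2 fun U => ?_
  have h1 : IsOpen[(R.uniformCore n).toTopologicalSpace] U ↔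
      ∀ T ∈ U, U ∈ @nhds _ (R.uniformCore n).toTopologicalSpace T :=
    @isOpen_iff_mem_nhds _ (R.uniformCore n).toTopologicalSpace U
  rw [h1]
  refine forall₂_congr fun T _ => ?_
  rw [UniformSpace.Core.nhds_toTopologicalSpace,
    ((R.uniformCore_hasBasis n).comap (Prod.mk T)).mem_iff]
  rfl

/-- The topology of the uniform structure is definitionally that of the big ball metric. -/
instance (n : ℕ) : UniformSpace (R.TilingSpace n) :=
  .ofCoreEq (R.uniformCore n) inferInstance (R.topology_eq n)

theorem uniformity_hasBasis (n : ℕ) :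
    (uniformity (R.TilingSpace n)).HasBasis (fun ε : ℝ => 0 < ε)
      fun ε => {p | Close (R.support n) ε p.1.1 p.2.1} :=
  R.uniformCore_hasBasis n

theorem nhds_hasBasis {n : ℕ} (T : R.TilingSpace n) :
    (𝓝 T).HasBasis (fun ε : ℝ => 0 < ε) fun ε => {T' | Close (R.support n) ε T.1 T'.1} :=
  nhds_basis_uniformity' (R.uniformity_hasBasis n)

instance (n : ℕ) : (uniformity (R.TilingSpace n)).IsCountablyGenerated := by
  have h := R.uniformity_hasBasis n
  have h' : (uniformity (R.TilingSpace n)).HasBasis (fun _ : ℕ => True)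
      fun m => {p | Close (R.support n) (1 / ((m : ℝ) + 1)) p.1.1 p.2.1} := by
    refine h.to_hasBasis (fun ε hε => ?_) fun m _ => ⟨_, by positivity, subset_rfl⟩
    obtain ⟨m, hm⟩ := exists_nat_one_div_lt hε
    exact ⟨m, trivial, fun p hp => Close.mono (by positivity) hm.le hp⟩
  exact h'.isCountablyGenerated

instance (n : ℕ) : T0Space (R.TilingSpace n) := by
  refine t0Space_iff_uniformity.2 fun T T' h => Subtype.ext ?_
  have h' : ∀ ε > 0, Close (R.support n) ε T.1 T'.1 := fun ε hε =>
    h _ ((R.uniformity_hasBasis n).mem_of_mem hε)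
  exact (subset_of_forall_close (R.isCompact_support n) (R.interior_support_nonempty n)
    T'.2.isTiling.nonOverlapping h').antisymm
    (subset_of_forall_close (R.isCompact_support n) (R.interior_support_nonempty n)
    T.2.isTiling.nonOverlapping fun ε hε => (h' ε hε).symm)

theorem vadd_val {n : ℕ} (v : E d) (T : R.TilingSpace n) : (v +ᵥ T).1 = translate v T.1 := rfl

instance (n : ℕ) : ContinuousVAdd (E d) (R.TilingSpace n) where
  continuous_vadd := by
    refine continuous_iff_continuousAt.2 fun ⟨v, T⟩ => ?_
    refine (R.nhds_hasBasis _).tendsto_right_iff.2 fun ε hε => ?_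
    obtain ⟨δ, hδ0, hδ, hδ'⟩ : ∃ δ : ℝ, 0 < δ ∧ 2 * δ ≤ ε ∧ 1 / ε + ‖v‖ ≤ 1 / δ := by
      refine ⟨min (ε / 2) (1 / (1 / ε + ‖v‖)), by positivity, ?_, ?_⟩
      · linarith [min_le_left (ε / 2) (1 / (1 / ε + ‖v‖))]
      · rw [le_div_iff₀ (by positivity)]
        have := min_le_right (ε / 2) (1 / (1 / ε + ‖v‖))
        rw [le_div_iff₀ (by positivity)] at this
        linarith
    filter_upwards [prod_mem_nhds (Metric.closedBall_mem_nhds v hδ0)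
      ((R.nhds_hasBasis T).mem_of_mem hδ0)]
    rintro ⟨v', T'⟩ ⟨hv, u, w, hu, hw, h⟩
    rw [Metric.mem_closedBall, dist_eq_norm, norm_sub_rev] at hv
    change Close (R.support n) ε (translate v T.1) (translate v' T'.1)
    refine ⟨u, w + (v - v'), by linarith, ?_, ?_⟩
    · linarith [norm_add_le w (v - v')]
    · have := h.translate hδ'
      simp only [translate_translate] at this ⊢
      convert this using 2 <;> abel

end FusionRule

/-! ### Finite local complexity -/

section FiniteComplexity

variable {ι : Type} {d : ℕ} {S : ι → Set (E d)}

theorem IsTiling.exists_mem {T : Set (ι × E d)} (h : IsTiling S T) (x : E d) :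
    ∃ t ∈ T, x ∈ tileSupport S t := by
  have : x ∈ patchSupport S T := by rw [h.covers]; trivial
  simpa [patchSupport] using this

/-- Suppose that the relative positions of touching tiles are confined to a finite set `V`. Then
the tiles within a fixed distance of the origin are confined to a finite set once the tiling is
normalized to have a tile at position `0`. Indeed the tiles meeting a ball are joined by chains of
touching tiles, as the ball is connected, and the number of these tiles bounds the lengths of the
chains. -/
theorem exists_finite_tilesMeeting [Finite ι] (hc : ∀ k, IsCompact (S k))
    (hi : ∀ k, (interior (S k)).Nonempty) {V : Set (ι × ι × E d)} (hV : V.Finite) (r : ℝ) :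
    ∃ Z : Set (ι × E d), Z.Finite ∧ ∀ T, IsTiling S T →
      (∀ s ∈ T, ∀ t ∈ T, s ≠ t → (tileSupport S s ∩ tileSupport S t).Nonempty →
        (s.1, t.1, t.2 - s.2) ∈ V) →
      ∀ k, (k, 0) ∈ T → tilesMeeting S r T ⊆ Z := by
  obtain ⟨D, hD0, hD⟩ := exists_bound hc
  obtain ⟨N, hN⟩ := exists_card_bound hc hi (max r D)
  -- `Z m` contains the tiles reached from a tile at position `0` by a chain of `m` steps in `V`.
  set step : Set (ι × E d) → Set (ι × E d) := fun Z =>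
    Z ∪ (fun q : (ι × E d) × (ι × ι × E d) => (q.2.2.1, q.1.2 + q.2.2.2)) '' (Z ×ˢ V) with hstep
  set Z : ℕ → Set (ι × E d) := fun m => step^[m] (Set.range fun k => (k, 0)) with hZ
  have hZsucc : ∀ m, Z (m + 1) = step (Z m) := fun m => Function.iterate_succ_apply' _ _ _
  have hZfin : ∀ m, (Z m).Finite := by
    intro m
    induction m with
    | zero => exact Set.finite_range _
    | succ m ih => rw [hZsucc]; exact ih.union ((ih.prod hV).image _)
  refine ⟨Z N, hZfin N, fun T hT hTV k hk => ?_⟩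
  set C := tilesMeeting S (max r D) T with hC
  obtain ⟨hCfin, hCN⟩ := hN T hT.nonOverlapping
  have hrC : tilesMeeting S r T ⊆ C := fun t ht => ⟨ht.1, ht.2.mono
    (Set.inter_subset_inter_right _ (Metric.closedBall_subset_closedBall (le_max_left _ _)))⟩
  refine hrC.trans ?_
  have hk0 : (k, (0 : E d)) ∈ C := by
    obtain ⟨x, hx⟩ := (interior_tileSupport_nonempty hi (k, (0 : E d))).mono interior_subset
    refine ⟨hk, x, hx, ?_⟩
    rw [mem_closedBall_zero_iff]
    have := hD _ x hx
    simp only [sub_zero] at this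
    exact this.trans (le_max_right _ _)
  -- As long as tiles of `C` are missing from `Z m`, the next step reaches a new one.
  have key : ∀ m, C ⊆ Z m ∨ m < (C ∩ Z m).ncard := by
    intro m
    induction m with
    | zero =>
      right
      rw [Set.ncard_pos (hCfin.inter_of_left _)]
      exact ⟨_, hk0, k, rfl⟩
    | succ m ih =>
      have hmono : Z m ⊆ Z (m + 1) := by rw [hZsucc]; exact Set.subset_union_left
      by_cases hsub : C ⊆ Z m
      · exact Or.inl (hsub.trans hmono)
      right
      have hlt := ih.resolve_left hsub
      have hne : (C ∩ Z m).Nonempty :=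
        (Set.ncard_pos (hCfin.inter_of_left _)).1 (Nat.zero_lt_of_lt hlt)
      obtain ⟨s₀, hs₀C, hs₀Z⟩ := hne
      obtain ⟨t₀, ht₀C, ht₀Z⟩ := Set.not_subset.1 hsub
      have hclosed : ∀ W ⊆ C, IsClosed (⋃ t ∈ W, tileSupport S t) := fun W hW =>
        (hCfin.subset hW).isClosed_biUnion fun t _ => (isCompact_tileSupport hc t).isClosed
      have hconn : IsPreconnected (Metric.closedBall (0 : E d) (max r D)) :=
        (convex_closedBall _ _).isPreconnected
      obtain ⟨x, hx, hxA, hxB⟩ := isPreconnected_closed_iff.1 hconn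
        (⋃ t ∈ C ∩ Z m, tileSupport S t) (⋃ t ∈ C \ Z m, tileSupport S t)
        (hclosed _ Set.inter_subset_left) (hclosed _ Set.sdiff_subset)
        (by
          intro x hx
          obtain ⟨t, ht, hxt⟩ := hT.exists_mem x
          have htC : t ∈ C := ⟨ht, x, hxt, hx⟩
          by_cases htZ : t ∈ Z m
          · exact Or.inl (Set.mem_biUnion (show t ∈ C ∩ Z m from ⟨htC, htZ⟩) hxt)
          · exact Or.inr (Set.mem_biUnion (show t ∈ C \ Z m from ⟨htC, htZ⟩) hxt))
        (by
          obtain ⟨y, hy, hy'⟩ := hs₀C.2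
          exact ⟨y, hy', Set.mem_biUnion (show s₀ ∈ C ∩ Z m from ⟨hs₀C, hs₀Z⟩) hy⟩)
        (by
          obtain ⟨y, hy, hy'⟩ := ht₀C.2
          exact ⟨y, hy', Set.mem_biUnion (show t₀ ∈ C \ Z m from ⟨ht₀C, ht₀Z⟩) hy⟩)
      simp only [Set.mem_iUnion, exists_prop] at hxA hxB
      obtain ⟨s, ⟨hsC, hsZ⟩, hxs⟩ := hxA
      obtain ⟨t, ⟨htC, htZ⟩, hxt⟩ := hxB
      have hst : s ≠ t := fun h => htZ (h ▸ hsZ)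
      have hmem := hTV s hsC.1 t htC.1 hst ⟨x, hxs, hxt⟩
      have htZ' : t ∈ Z (m + 1) := by
        rw [hZsucc]
        exact Or.inr ⟨(s, _), ⟨hsZ, hmem⟩, by ext <;> simp⟩
      refine Nat.lt_of_le_of_lt (Nat.succ_le_of_lt hlt)
        (Set.ncard_lt_ncard ⟨Set.inter_subset_inter_right _ hmono, fun h => ?_⟩
          (hCfin.inter_of_left _))
      exact htZ (h ⟨htC, htZ'⟩).2
  refine (key N).resolve_right fun h => ?_
  exact absurd h (not_lt.2 ((Set.ncard_le_ncard Set.inter_subset_left hCfin).trans hCN))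

end FiniteComplexity

/-! ### The hierarchy of supertiles of a fusion tiling -/

namespace FusionRule

variable {d : ℕ} {R : FusionRule d}

/-- `H N` is a tiling by `N`-supertiles for each `N`, the `N`-supertiles being obtained by
subdividing the `(N+1)`-supertiles, and the `0`-supertiles are the tiles of `T`. -/
structure IsHierarchy (T : R.X) (H : ∀ N, R.TilingSpace N) : Prop where
  zero : H 0 = T
  subdivide : ∀ N, (H N).1 = R.subdivide N (H (N + 1)).1

theorem Recognizable.exists_hierarchy (hrec : R.Recognizable) (T : R.X) :
    ∃ H, IsHierarchy T H := by
  choose h hh using hrec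
  refine ⟨fun N => Nat.rec T (fun N Q => (h N).symm Q) N, rfl, fun N => ?_⟩
  rw [← hh]
  simp

variable (R) in
/-- The tiles that make up the `N`-supertile of type `l`. -/
def constituents : ∀ N, Fin (R.j N) → Set (Fin (R.j 0) × E d)
  | 0, l => {(l, 0)}
  | N + 1, l => ⋃ t ∈ R.fusion N l, translate t.2 (constituents N t.1)

theorem supertile_zero_eq_constituents :
    ∀ m (l : Fin (R.j (0 + m))), R.supertile 0 m l = R.constituents (0 + m) l
  | 0, _ => rfl
  | m + 1, l => by
    change (⋃ t ∈ R.fusion (0 + m) l, translate t.2 (R.supertile 0 m t.1)) =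
      ⋃ t ∈ R.fusion (0 + m) l, translate t.2 (R.constituents (0 + m) t.1)
    simp only [supertile_zero_eq_constituents m]

theorem tileSupport_subset_of_mem_constituents :
    ∀ N (l : Fin (R.j N)), ∀ t ∈ R.constituents N l,
      tileSupport (R.support 0) t ⊆ R.support N l
  | 0, l, t, ht => by
    obtain rfl : t = (l, 0) := ht
    intro x hx
    simpa [mem_tileSupport] using hx
  | N + 1, l, t, ht => by
    simp only [constituents, Set.mem_iUnion] at ht
    obtain ⟨s, hs, ht⟩ := ht
    rw [mem_translate] at ht
    have ih := tileSupport_subset_of_mem_constituents N s.1 _ ht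
    intro x hx
    rw [R.support_succ, patchSupport]
    refine Set.mem_biUnion hs (mem_tileSupport.2 (ih ?_))
    rw [mem_tileSupport] at hx ⊢
    simpa using hx

namespace IsHierarchy

variable {T : R.X} {H : ∀ N, R.TilingSpace N}

theorem mem_succ (hH : IsHierarchy T H) {N : ℕ} {t : Fin (R.j (N + 1)) × E d}
    (ht : t ∈ (H (N + 1)).1) {s : Fin (R.j N) × E d} (hs : s ∈ R.fusion N t.1) :
    (s.1, t.2 + s.2) ∈ (H N).1 := by
  rw [hH.subdivide]
  exact Set.mem_biUnion ht (Set.mem_image_of_mem _ hs)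

theorem mem_iff (hH : IsHierarchy T H) (N : ℕ) (t : Fin (R.j 0) × E d) :
    t ∈ T.1 ↔ ∃ s ∈ (H N).1, t ∈ translate s.2 (R.constituents N s.1) := by
  induction N with
  | zero =>
    rw [← hH.zero]
    constructor
    · exact fun ht => ⟨t, ht, by simp [mem_translate, constituents]⟩
    · rintro ⟨s, hs, ht⟩
      simp only [mem_translate, constituents, Set.mem_singleton_iff, Prod.mk.injEq, sub_eq_zero]
        at ht
      obtain rfl : t = s := Prod.ext ht.1 ht.2
      exact hs
  | succ N ih =>
    rw [ih]
    constructor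
    · rintro ⟨s, hs, ht⟩
      rw [hH.subdivide] at hs
      simp only [FusionRule.subdivide, Set.mem_iUnion] at hs
      obtain ⟨u, hu, hs⟩ := hs
      rw [mem_translate] at hs ht
      refine ⟨u, hu, ?_⟩
      rw [mem_translate, constituents]
      refine Set.mem_biUnion hs ?_
      rw [mem_translate]
      convert ht using 2
      exact sub_sub_sub_cancel_right t.2 s.2 u.2
    · rintro ⟨u, hu, ht⟩
      rw [mem_translate, constituents] at ht
      simp only [Set.mem_iUnion] at ht
      obtain ⟨s, hs, ht⟩ := ht
      refine ⟨_, hH.mem_succ hu hs, ?_⟩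
      rw [mem_translate] at ht ⊢
      convert ht using 2
      change t.2 - (u.2 + s.2) = t.2 - u.2 - s.2
      exact (sub_sub _ _ _).symm

theorem translate_constituents_subset (hH : IsHierarchy T H) {N : ℕ} {k : Fin (R.j N)} {p : E d}
    (h : (k, p) ∈ (H N).1) : translate p (R.constituents N k) ⊆ T.1 :=
  fun t ht => (hH.mem_iff N t).2 ⟨_, h, ht⟩

/-- The tiles of `T` that meet the interior of an `N`-supertile are its constituents. -/
theorem mem_iff_of_meets_interior (hH : IsHierarchy T H) {N : ℕ} {k : Fin (R.j N)} {p : E d}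
    (h : (k, p) ∈ (H N).1) {t : Fin (R.j 0) × E d}
    (ht : (tileSupport (R.support 0) t ∩ interior (tileSupport (R.support N) (k, p))).Nonempty) :
    t ∈ T.1 ↔ t ∈ translate p (R.constituents N k) := by
  refine ⟨fun htT => ?_, fun ht => hH.translate_constituents_subset h ht⟩
  obtain ⟨s, hs, hts⟩ := (hH.mem_iff N t).1 htT
  obtain ⟨x, hxt, hx⟩ := ht
  have hxs : x ∈ tileSupport (R.support N) s := by
    rw [mem_tileSupport]
    refine tileSupport_subset_of_mem_constituents N s.1 _ (mem_translate.1 hts) ?_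
    rw [mem_tileSupport] at hxt ⊢
    simpa using hxt
  have := (H N).2.isTiling.nonOverlapping.eq_of_mem h hs hx hxs
  rw [← this] at hts
  exact hts

/-- By strong primitivity every supertile of level at least `1` occurs in every tiling. -/
theorem exists_mem (hprim : R.StronglyPrimitive) (hH : IsHierarchy T H) {N : ℕ}
    (hN : 1 ≤ N) (k : Fin (R.j N)) : ∃ p, (k, p) ∈ (H N).1 := by
  obtain ⟨t, ht, -⟩ := (H (N + 1)).2.isTiling.exists_mem 0
  have := hprim N hN k t.1
  rw [transition, Finset.card_pos] at this
  obtain ⟨s, hs⟩ := this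
  rw [Finset.mem_filter] at hs
  obtain ⟨hs, rfl⟩ := hs
  exact ⟨_, hH.mem_succ ht hs⟩

end IsHierarchy

/-- The relative positions of touching tiles are confined to a finite set which is the same for
all tilings, since every two-tile patch of one tiling is found in any other. -/
theorem exists_finite_differences (hne : Nonempty R.X)
    (hflc : ∀ T : R.X, IsFLC (R.support 0) T.1) (hprim : R.StronglyPrimitive)
    (hrec : R.Recognizable) :
    ∃ V : Set (Fin (R.j 0) × Fin (R.j 0) × E d), V.Finite ∧ ∀ T : R.X,
      ∀ s ∈ T.1, ∀ t ∈ T.1, s ≠ t →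
        (tileSupport (R.support 0) s ∩ tileSupport (R.support 0) t).Nonempty →
        (s.1, t.1, t.2 - s.2) ∈ V := by
  obtain ⟨T₀⟩ := hne
  obtain ⟨H, hH⟩ := hrec.exists_hierarchy T₀
  obtain ⟨F, hF, hFT⟩ := hflc T₀
  -- The members of the finite family `F` that are not finite sets play no role.
  refine ⟨⋃ Q ∈ {Q ∈ F | Q.Finite},
    (fun q : (Fin (R.j 0) × E d) × (Fin (R.j 0) × E d) => (q.1.1, q.2.1, q.2.2 - q.1.2)) ''
      (Q ×ˢ Q), ?_, fun T s hs t ht hst htouch => ?_⟩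
  · exact (hF.subset (Set.sep_subset _ _)).biUnion fun Q hQ => (hQ.2.prod hQ.2).image _
  have hconn : ∀ q : Fin (R.j 0) × E d, IsConnected (tileSupport (R.support 0) q) := fun q =>
    (R.prototile_disk q.1).isConnected.image _ (Homeomorph.addLeft q.2).continuous.continuousOn
  have hpatch : IsPatch (R.support 0) {s, t} := by
    refine ⟨Set.toFinite _, T.2.isTiling.nonOverlapping.mono ?_, ?_⟩
    · rintro q (rfl | rfl) <;> assumption
    · rw [patchSupport, Set.biUnion_pair]
      exact (hconn s).union htouch (hconn t)
  obtain ⟨m, l, v, hv⟩ := T.2.admitted {s, t} (by rintro q (rfl | rfl) <;> assumption) hpatch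
  have hsv : (s.1, v + s.2) ∈ R.supertile 0 m l := hv ⟨s, by simp, rfl⟩
  have htv : (t.1, v + t.2) ∈ R.supertile 0 m l := hv ⟨t, by simp, rfl⟩
  -- A `0`-supertile is a single tile, so the two distinct tiles lie in one of higher level.
  have hm : 1 ≤ m := by
    by_contra h
    obtain rfl : m = 0 := by omega
    have h1 : (s.1, v + s.2) = (l, 0) := hsv
    have h2 : (t.1, v + t.2) = (l, 0) := htv
    rw [Prod.mk.injEq] at h1 h2
    exact hst (Prod.ext (h1.1.trans h2.1.symm) (add_left_cancel (h1.2.trans h2.2.symm)))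
  obtain ⟨p, hp⟩ := hH.exists_mem hprim (N := 0 + m) (by omega) l
  rw [supertile_zero_eq_constituents] at hsv htv
  have hs₀ : (s.1, (p + v) + s.2) ∈ T₀.1 := by
    have := hH.translate_constituents_subset hp ⟨_, hsv, rfl⟩
    rwa [add_assoc]
  have ht₀ : (t.1, (p + v) + t.2) ∈ T₀.1 := by
    have := hH.translate_constituents_subset hp ⟨_, htv, rfl⟩
    rwa [add_assoc]
  have hpair : translate (p + v) {s, t} = {(s.1, (p + v) + s.2), (t.1, (p + v) + t.2)} := by
    rw [translate, Set.image_pair]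
  obtain ⟨w, hw⟩ := hFT _ hs₀ _ ht₀
    (fun h => hst (Prod.ext (Prod.mk.inj h).1 (add_left_cancel (Prod.mk.inj h).2)))
    (by rw [← hpair]; exact hpatch.translate _)
  refine Set.mem_biUnion (show _ ∈ {Q ∈ F | Q.Finite} from
    ⟨hw, (Set.toFinite _).image _⟩) ?_
  refine ⟨((s.1, w + ((p + v) + s.2)), (t.1, w + ((p + v) + t.2))), ⟨?_, ?_⟩, ?_⟩
  · exact ⟨_, Or.inl rfl, rfl⟩
  · exact ⟨_, Or.inr rfl, rfl⟩
  · simp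

/-- The tiling space is compact. Translate the tilings so that each has a tile at position `0`.
Near the origin only finitely many tiles are then possible, so along an ultrafilter the tilings
stabilize on every ball; the limit consists of the tiles that eventually belong to them. -/
theorem compactSpace (hne : Nonempty R.X)
    (hflc : ∀ T : R.X, IsFLC (R.support 0) T.1) (hprim : R.StronglyPrimitive)
    (hrec : R.Recognizable) : CompactSpace R.X := by
  obtain ⟨V, hVfin, hV⟩ := exists_finite_differences hne hflc hprim hrec
  obtain ⟨D, hD0, hD⟩ := exists_bound (R.isCompact_support 0)
  refine ⟨isCompact_iff_ultrafilter_le_nhds.2 fun 𝓕 _ => ?_⟩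
  have hex : ∀ T : R.X, ∃ t ∈ T.1, (0 : E d) ∈ tileSupport (R.support 0) t := fun T =>
    T.2.isTiling.exists_mem 0
  choose t ht h0t using hex
  -- `Y T` is `T` translated so that the chosen tile covering the origin is at position `0`.
  set u : R.X → E d := fun T => (t T).2
  have hu : ∀ T, u T ∈ Metric.closedBall (0 : E d) D := fun T => by
    rw [mem_closedBall_zero_iff]; simpa using hD _ _ (h0t T)
  set Y : R.X → R.X := fun T => (-u T) +ᵥ T
  have hY0 : ∀ T, ((t T).1, (0 : E d)) ∈ (Y T).1 := fun T => by
    change _ ∈ translate (-u T) T.1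
    rw [mem_translate]
    simpa [u] using ht T
  set T' : Set (Fin (R.j 0) × E d) := {q | ∀ᶠ T in (𝓕 : Filter R.X), q ∈ (Y T).1} with hT'
  have hagree : ∀ r, ∀ᶠ T in (𝓕 : Filter R.X), AgreeOnBall (R.support 0) r T' (Y T).1 := by
    intro r
    obtain ⟨Z, hZ, hYZ⟩ := exists_finite_tilesMeeting (R.isCompact_support 0)
      (R.interior_support_nonempty 0) hVfin r
    have hYZ' : ∀ T, tilesMeeting (R.support 0) r (Y T).1 ⊆ Z := fun T =>
      hYZ _ (Y T).2.isTiling (hV (Y T)) _ (hY0 T)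
    have hev : ∀ᶠ T in (𝓕 : Filter R.X), ∀ q ∈ Z, (q ∈ T' ↔ q ∈ (Y T).1) := by
      refine (Filter.eventually_all_finite hZ).2 fun q _ => ?_
      rcases 𝓕.em (fun T => q ∈ (Y T).1) with h | h
      · filter_upwards [h] with T hT using ⟨fun _ => hT, fun _ => h⟩
      · filter_upwards [h] with T hT
        refine ⟨fun h' => ?_, fun h' => absurd h' hT⟩
        obtain ⟨T₁, h₁, h₂⟩ := ((show ∀ᶠ T in (𝓕 : Filter R.X), q ∈ (Y T).1 from h').and h).exists
        exact absurd h₁ h₂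
    filter_upwards [hev] with T hT q hq
    by_cases hqZ : q ∈ Z
    · exact hT q hqZ
    · refine ⟨fun h => ?_, fun h => absurd (hYZ' T ⟨h, hq⟩) hqZ⟩
      obtain ⟨T₁, h₁⟩ := (show ∀ᶠ T in (𝓕 : Filter R.X), q ∈ (Y T).1 from h).exists
      exact absurd (hYZ' T₁ ⟨h₁, hq⟩) hqZ
  have hT'mem : R.IsFusionTiling 0 T' := by
    refine ⟨⟨Set.eq_univ_of_forall fun x => ?_, fun q hq q' hq' hqq' => ?_⟩, fun Q hQ hp => ?_⟩
    · obtain ⟨T, hT⟩ := (hagree ‖x‖).exists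
      obtain ⟨q, hq, hxq⟩ := (Y T).2.isTiling.exists_mem x
      exact Set.mem_biUnion ((hT q ⟨x, hxq, by simp⟩).2 hq) hxq
    · obtain ⟨T, hT, hT₁⟩ := (hq.and hq').exists
      exact (Y T).2.isTiling.nonOverlapping hT hT₁ hqq'
    · obtain ⟨T, hT⟩ := ((Filter.eventually_all_finite hp.finite).2 fun q hq => hQ hq).exists
      exact (Y T).2.admitted Q hT hp
  set L : R.X := ⟨T', hT'mem⟩
  have hYlim : Tendsto Y 𝓕 (𝓝 L) := by
    refine (R.nhds_hasBasis _).tendsto_right_iff.2 fun ε hε => ?_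
    filter_upwards [hagree (1 / ε)] with T hT
    refine ⟨0, 0, by simpa using hε.le, by simpa using hε.le, ?_⟩
    rwa [translate_zero, translate_zero]
  obtain ⟨u₀, -, hu₀⟩ := isCompact_iff_ultrafilter_le_nhds.1 (isCompact_closedBall (0 : E d) D)
    (𝓕.map u) (by
      rw [le_principal_iff]
      exact Filter.mem_map.2 (Filter.univ_mem' hu))
  refine ⟨u₀ +ᵥ L, trivial, ?_⟩
  have hlim : Tendsto (fun T => u T +ᵥ Y T) 𝓕 (𝓝 (u₀ +ᵥ L)) :=
    Tendsto.vadd (show Tendsto u 𝓕 (𝓝 u₀) from hu₀) hYlim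
  have hid : (fun T => u T +ᵥ Y T) = id := by
    funext T
    simp [Y]
  rwa [hid, tendsto_id'] at hlim

end FusionRule

/-! ### Integration over supertiles -/

section Integration

variable {ι : Type} {d : ℕ} {S : ι → Set (E d)}

/-- A closed ball about a point of `A` that is farther than the radius from the boundary of `A`
stays inside `A`, since it is connected. -/
theorem closedBall_subset_interior {A : Set (E d)} {r : ℝ} (hr : 0 ≤ r) {x : E d} (hx : x ∈ A)
    (hxr : x ∉ Metric.cthickening r (frontier A)) : Metric.closedBall x r ⊆ interior A := by
  have hxi : x ∈ interior A := by
    rw [← self_sdiff_frontier]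
    exact ⟨hx, fun h => hxr (Metric.self_subset_cthickening _ h)⟩
  refine (convex_closedBall x r).isPreconnected.subset_of_closure_inter_subset isOpen_interior
    ⟨x, Metric.mem_closedBall_self hr, hxi⟩ ?_
  rintro y ⟨hy, hyx⟩
  by_contra hyi
  refine hxr (Metric.mem_cthickening_of_dist_le x y r _
    ⟨closure_mono interior_subset hy, hyi⟩ ?_)
  rw [dist_comm]
  exact hyx

theorem abs_setIntegral_le {M : ℝ} {g : E d → ℝ} (hM : ∀ x, |g x| ≤ M) {A : Set (E d)}
    (hA : volume A ≠ ⊤) : |∫ x in A, g x| ≤ M * volume.real A := by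
  have := norm_setIntegral_le_of_norm_le_const (f := g) (C := M) (s := A) (μ := volume) hA.lt_top
    fun x _ => hM x
  rwa [Real.norm_eq_abs] at this

theorem integrableOn_of_bounded {M : ℝ} {g : E d → ℝ} (hg : Continuous g) (hM : ∀ x, |g x| ≤ M)
    {A : Set (E d)} (hA : volume A ≠ ⊤) : IntegrableOn g A :=
  Measure.integrableOn_of_bounded hA hg.aestronglyMeasurable (Eventually.of_forall hM)

theorem abs_setIntegral_sub_le {M : ℝ} {g : E d → ℝ} (hg : Continuous g) (hM : ∀ x, |g x| ≤ M)
    {A B : Set (E d)} (hBA : B ⊆ A) (hB : MeasurableSet B) (hA : volume A ≠ ⊤) :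
    |(∫ x in A, g x) - ∫ x in B, g x| ≤ M * volume.real (A \ B) := by
  rw [← setIntegral_sdiff hB (integrableOn_of_bounded hg hM hA) hBA]
  exact abs_setIntegral_le hM (measure_ne_top_of_subset Set.sdiff_subset hA)

theorem setIntegral_tileSupport (g : E d → ℝ) (k : ι) (p : E d) :
    ∫ x in tileSupport S (k, p), g x = ∫ x in S k, g (p + x) :=
  (measurePreserving_add_left volume p).setIntegral_image_emb
    (Homeomorph.addLeft p).measurableEmbedding g (S k)

theorem volume_real_tileSupport (t : ι × E d) :
    volume.real (tileSupport S t) = volume.real (S t.1) := by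
  rw [measureReal_def, tileSupport_eq_image, volume_addLeft_image, measureReal_def]

theorem volume_real_frontier_tileSupport (t : ι × E d) :
    volume.real (frontier (tileSupport S t)) = volume.real (frontier (S t.1)) := by
  rw [measureReal_def, frontier_tileSupport, volume_addLeft_image, measureReal_def]

theorem volume_frontier_ne_top {A : Set (E d)} (hA : IsCompact A) :
    volume (frontier A) ≠ ⊤ :=
  measure_ne_top_of_subset hA.isClosed.frontier_subset hA.measure_lt_top.ne

/-- Integrals are additive over non-overlapping tiles up to the volume of the boundaries, which
need not be negligible. -/
theorem abs_setIntegral_patchSupport_sub_le (hc : ∀ k, IsCompact (S k)) {M : ℝ} {g : E d → ℝ}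
    (hg : Continuous g) (hM : ∀ x, |g x| ≤ M) (Q : Finset (ι × E d))
    (hQ : NonOverlapping S (Q : Set (ι × E d))) :
    |(∫ x in patchSupport S Q, g x) - ∑ t ∈ Q, ∫ x in tileSupport S t, g x| ≤
      2 * M * ∑ t ∈ Q, volume.real (frontier (S t.1)) := by
  have hM0 : 0 ≤ M := (abs_nonneg _).trans (hM 0)
  have hct := isCompact_tileSupport hc
  -- On the union `U₀` of the interiors the integral is exactly additive.
  set U₀ : Set (E d) := ⋃ t ∈ Q, interior (tileSupport S t) with hU₀
  have hUc : IsCompact (patchSupport S (Q : Set (ι × E d))) :=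
    Q.finite_toSet.isCompact_biUnion fun t _ => hct t
  have hsub : U₀ ⊆ patchSupport S (Q : Set (ι × E d)) :=
    Set.iUnion₂_mono fun t _ => interior_subset
  have hsum : ∫ x in U₀, g x = ∑ t ∈ Q, ∫ x in interior (tileSupport S t), g x := by
    refine integral_biUnion_finset Q (fun t _ => isOpen_interior.measurableSet)
      (fun s hs t ht hst => ?_) fun t _ => ?_
    · exact (hQ hs ht hst).disjoint_interior.mono_right interior_subset
    · exact (integrableOn_of_bounded hg hM (hct t).measure_lt_top.ne).mono_set interior_subset
  have h1 : |(∫ x in patchSupport S Q, g x) - ∫ x in U₀, g x| ≤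
      M * ∑ t ∈ Q, volume.real (frontier (S t.1)) := by
    refine (abs_setIntegral_sub_le hg hM hsub
      (isOpen_biUnion fun t _ => isOpen_interior).measurableSet hUc.measure_lt_top.ne).trans ?_
    refine mul_le_mul_of_nonneg_left ?_ hM0
    have hfr : patchSupport S (Q : Set (ι × E d)) \ U₀ ⊆ ⋃ t ∈ Q, frontier (tileSupport S t) := by
      rintro x ⟨hx, hx₀⟩
      simp only [patchSupport, Set.mem_iUnion, hU₀, not_exists] at hx hx₀ ⊢
      obtain ⟨t, ht, hxt⟩ := hx
      exact ⟨t, ht, subset_closure hxt, hx₀ t ht⟩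
    calc _ ≤ volume.real (⋃ t ∈ Q, frontier (tileSupport S t)) :=
          measureReal_mono hfr ((measure_biUnion_lt_top Q.finite_toSet fun t _ =>
            (volume_frontier_ne_top (hct t)).lt_top).ne)
      _ ≤ ∑ t ∈ Q, volume.real (frontier (tileSupport S t)) :=
          measureReal_biUnion_finset_le _ _
      _ = _ := by simp only [volume_real_frontier_tileSupport]
  have h2 : |(∫ x in U₀, g x) - ∑ t ∈ Q, ∫ x in tileSupport S t, g x| ≤
      M * ∑ t ∈ Q, volume.real (frontier (S t.1)) := by
    rw [hsum, ← Finset.sum_sub_distrib, Finset.mul_sum]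
    refine (Finset.abs_sum_le_sum_abs _ _).trans (Finset.sum_le_sum fun t _ => ?_)
    rw [abs_sub_comm]
    refine (abs_setIntegral_sub_le hg hM interior_subset isOpen_interior.measurableSet
      (hct t).measure_lt_top.ne).trans ?_
    rw [← (hct t).isClosed.frontier_eq, volume_real_frontier_tileSupport]
  calc _ ≤ _ := abs_sub_le _ (∫ x in U₀, g x) _
    _ ≤ _ := add_le_add h1 h2
    _ = _ := by ring

/-- Comparison of two averages `I / V` and `J / W` whose terms nearly agree. -/
theorem abs_div_sub_div_le {I J V W M a b : ℝ} (hV : 0 < V) (hW : 0 < W)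
    (hI : |I| ≤ M * V) (hIJ : |I - J| ≤ a * W) (hVW : |V - W| ≤ b * W) :
    |I / V - J / W| ≤ a + M * b := by
  have hM : 0 ≤ M := by
    by_contra h
    have := (abs_nonneg I).trans hI
    nlinarith
  have h : I / V - J / W = (I - J) / W + I / V * ((W - V) / W) := by
    field_simp
    ring
  have h1 : |(I - J) / W| ≤ a := by
    rw [abs_div, abs_of_pos hW]; exact (div_le_iff₀ hW).2 hIJ
  have h2 : |I / V| ≤ M := by
    rw [abs_div, abs_of_pos hV]; exact (div_le_iff₀ hV).2 hI
  have h3 : |(W - V) / W| ≤ b := by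
    rw [abs_div, abs_of_pos hW, abs_sub_comm]; exact (div_le_iff₀ hW).2 hVW
  rw [h]
  refine (abs_add_le _ _).trans (add_le_add h1 ?_)
  rw [abs_mul]
  exact mul_le_mul h2 h3 (abs_nonneg _) hM

theorem abs_sub_div_le {I V a θ : ℝ} (hV : 0 < V) (h : |I - a * V| ≤ θ * V) :
    |a - I / V| ≤ θ := by
  have : a - I / V = -((I - a * V) / V) := by field_simp; ring
  rw [this, abs_neg, abs_div, abs_of_pos hV]
  exact (div_le_iff₀ hV).2 h

/-- Suppose that the boundaries of the tiles are relatively small and that the average of `g` over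
every tile of a patch is nearly a number `a k` which depends only on the type `k` of the tile. Then
the average of `g` over the patch is nearly the corresponding weighted average of the `a k`. -/
theorem abs_average_patchSupport_sub_le (hc : ∀ k, IsCompact (S k))
    (hi : ∀ k, (interior (S k)).Nonempty) {M η θ : ℝ} {g : E d → ℝ}
    (hg : Continuous g) (hM : ∀ x, |g x| ≤ M)
    (hη : ∀ k, volume.real (frontier (S k)) ≤ η * volume.real (S k))
    (Q : Finset (ι × E d)) (hQ : NonOverlapping S (Q : Set (ι × E d))) (hQne : Q.Nonempty)
    (a : ι → ℝ) (ha : ∀ t ∈ Q, |(∫ x in tileSupport S t, g x) - a t.1 * volume.real (S t.1)| ≤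
      θ * volume.real (S t.1)) :
    |(∫ x in patchSupport S Q, g x) / volume.real (patchSupport S (Q : Set (ι × E d))) -
      (∑ t ∈ Q, a t.1 * volume.real (S t.1)) / ∑ t ∈ Q, volume.real (S t.1)| ≤
      θ + 4 * M * η := by
  have hM0 : 0 ≤ M := (abs_nonneg _).trans (hM 0)
  have hUc : IsCompact (patchSupport S (Q : Set (ι × E d))) :=
    Q.finite_toSet.isCompact_biUnion fun t _ => isCompact_tileSupport hc t
  have hpos : ∀ k, 0 < volume.real (S k) := fun k =>
    ENNReal.toReal_pos (Measure.measure_pos_of_nonempty_interior _ (hi k)).ne'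
      (hc k).measure_lt_top.ne
  have hW : 0 < ∑ t ∈ Q, volume.real (S t.1) := Finset.sum_pos (fun t _ => hpos _) hQne
  have hfr : ∑ t ∈ Q, volume.real (frontier (S t.1)) ≤ η * ∑ t ∈ Q, volume.real (S t.1) := by
    rw [Finset.mul_sum]
    exact Finset.sum_le_sum fun t _ => hη _
  have hV : 0 < volume.real (patchSupport S (Q : Set (ι × E d))) := by
    obtain ⟨t, ht⟩ := hQne
    refine (hpos t.1).trans_le ?_
    rw [← volume_real_tileSupport]
    exact measureReal_mono (Set.subset_biUnion_of_mem (u := tileSupport S) ht)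
      hUc.measure_lt_top.ne
  have h1 := abs_setIntegral_patchSupport_sub_le hc hg hM Q hQ
  have h2 := abs_setIntegral_patchSupport_sub_le hc (M := 1) (g := fun _ => 1) continuous_const
    (by simp) Q hQ
  simp only [integral_const, measureReal_restrict_apply_univ, smul_eq_mul, mul_one,
    volume_real_tileSupport] at h2
  refine (abs_div_sub_div_le (a := θ + 2 * M * η) (b := 2 * η) hV hW
    (abs_setIntegral_le hM hUc.measure_lt_top.ne) ?_ ?_).trans_eq (by ring)
  · have h3 : |(∑ t ∈ Q, ∫ x in tileSupport S t, g x) - ∑ t ∈ Q, a t.1 * volume.real (S t.1)| ≤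
        θ * ∑ t ∈ Q, volume.real (S t.1) := by
      rw [← Finset.sum_sub_distrib, Finset.mul_sum]
      exact (Finset.abs_sum_le_sum_abs _ _).trans (Finset.sum_le_sum ha)
    calc _ ≤ _ := abs_sub_le _ (∑ t ∈ Q, ∫ x in tileSupport S t, g x) _
      _ ≤ 2 * M * (η * ∑ t ∈ Q, volume.real (S t.1)) + θ * ∑ t ∈ Q, volume.real (S t.1) :=
        add_le_add (h1.trans (mul_le_mul_of_nonneg_left hfr (by positivity))) h3
      _ = _ := by ring
  · refine h2.trans ?_
    linarith

end Integration

/-- Doeblin's contraction: two probability vectors that both dominate `ε` times a common one give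
averages whose difference is at most `1 - ε` times the oscillation. -/
theorem abs_sum_sub_sum_le_of_minorization {ι : Type} [Fintype ι] [Nonempty ι]
    {w w' π a : ι → ℝ} {ε o : ℝ}
    (hw : ∑ k, w k = 1) (hw' : ∑ k, w' k = 1) (hπ : ∑ k, π k = 1)
    (hwπ : ∀ k, ε * π k ≤ w k) (hwπ' : ∀ k, ε * π k ≤ w' k) (ha : ∀ k k', |a k - a k'| ≤ o) :
    |∑ k, w k * a k - ∑ k, w' k * a k| ≤ (1 - ε) * o := by
  obtain ⟨k₀, hk₀⟩ := Finite.exists_min a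
  have key : ∀ u : ι → ℝ, ∑ k, u k = 1 → (∀ k, ε * π k ≤ u k) →
      (1 - ε) * a k₀ ≤ ∑ k, (u k - ε * π k) * a k ∧
      ∑ k, (u k - ε * π k) * a k ≤ (1 - ε) * (a k₀ + o) := by
    intro u hu huπ
    have hs : ∑ k, (u k - ε * π k) = 1 - ε := by
      rw [Finset.sum_sub_distrib, ← Finset.mul_sum, hu, hπ, mul_one]
    rw [← hs, Finset.sum_mul, Finset.sum_mul]
    refine ⟨Finset.sum_le_sum fun k _ => ?_, Finset.sum_le_sum fun k _ => ?_⟩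
    · exact mul_le_mul_of_nonneg_left (hk₀ k) (by linarith [huπ k])
    · refine mul_le_mul_of_nonneg_left ?_ (by linarith [huπ k])
      linarith [le_abs_self (a k - a k₀), ha k k₀]
  have e : ∀ u : ι → ℝ, ∑ k, (u k - ε * π k) * a k = ∑ k, u k * a k - ∑ k, ε * π k * a k := by
    intro u
    rw [← Finset.sum_sub_distrib]
    exact Finset.sum_congr rfl fun k _ => by ring
  have h1 := key w hw hwπ
  have h2 := key w' hw' hwπ'
  rw [e] at h1 h2
  rw [abs_le]
  constructor <;> linarith [h1.1, h1.2, h2.1, h2.2]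

/-! ### Averages of a continuous function over supertiles -/

namespace FusionRule

variable {d : ℕ} {R : FusionRule d}

/-- The function `f` along the orbit of `T`: its value at `x` is the value of `f` at the tiling
`T` with the point `x` moved to the origin. -/
def orbitMap (f : R.X → ℝ) (T : R.X) (x : E d) : ℝ := f (-x +ᵥ T)

theorem continuous_orbitMap {f : R.X → ℝ} (hf : Continuous f) (T : R.X) :
    Continuous (orbitMap f T) :=
  hf.comp (continuous_neg.vadd continuous_const)

theorem nonempty_type (hne : Nonempty R.X) (hrec : R.Recognizable) (N : ℕ) :
    Nonempty (Fin (R.j N)) := by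
  obtain ⟨T⟩ := hne
  obtain ⟨H, -⟩ := hrec.exists_hierarchy T
  obtain ⟨t, -, -⟩ := (H N).2.isTiling.exists_mem 0
  exact ⟨t.1⟩

/-- The van Hove property is uniform in the type of the supertile. -/
theorem VanHove.eventually_le (hvh : R.VanHove) (hj : ∀ N, Nonempty (Fin (R.j N))) {r η : ℝ}
    (hr : 0 ≤ r) (hη : 0 < η) :
    ∀ᶠ N in atTop, ∀ k, volume.real (Metric.cthickening r (frontier (R.support N k))) ≤
      η * volume.real (R.support N k) := by
  have hex : ∀ N, ∃ k : Fin (R.j N),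
      volume.real (Metric.cthickening r (frontier (R.support N k))) ≤
        η * volume.real (R.support N k) →
      ∀ k, volume.real (Metric.cthickening r (frontier (R.support N k))) ≤
        η * volume.real (R.support N k) := by
    intro N
    by_cases h : ∀ k, volume.real (Metric.cthickening r (frontier (R.support N k))) ≤
        η * volume.real (R.support N k)
    · exact ⟨(hj N).some, fun _ => h⟩
    · push Not at h
      obtain ⟨k, hk⟩ := h
      exact ⟨k, fun h' => absurd h' (not_le.2 hk)⟩
  choose c hc using hex
  filter_upwards [(hvh c r hr).eventually_lt_const hη] with N hN
  exact hc N ((div_le_iff₀ (R.volume_support_pos N (c N))).1 hN.le)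

/-- Around a point deep inside an `N`-supertile the tiling is determined by the type of the
supertile and the position of the point in it. -/
theorem IsHierarchy.agreeOnBall {T T' : R.X} {H H' : ∀ N, R.TilingSpace N}
    (hH : IsHierarchy T H) (hH' : IsHierarchy T' H') {N : ℕ} {k : Fin (R.j N)} {p p' : E d}
    (hp : (k, p) ∈ (H N).1) (hp' : (k, p') ∈ (H' N).1) {r : ℝ} (hr : 0 ≤ r) {x : E d}
    (hx : x ∈ R.support N k) (hxr : x ∉ Metric.cthickening r (frontier (R.support N k))) :
    AgreeOnBall (R.support 0) r (-(p + x) +ᵥ T).1 (-(p' + x) +ᵥ T').1 := by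
  have key : ∀ {T : R.X} {H : ∀ N, R.TilingSpace N} {p : E d}, IsHierarchy T H →
      (k, p) ∈ (H N).1 → ∀ t : Fin (R.j 0) × E d,
      (tileSupport (R.support 0) t ∩ Metric.closedBall 0 r).Nonempty →
      (t ∈ (-(p + x) +ᵥ T).1 ↔ (t.1, t.2 + x) ∈ R.constituents N k) := by
    intro T H p hH hp t ht
    have e1 : t ∈ (-(p + x) +ᵥ T).1 ↔ (t.1, t.2 + (p + x)) ∈ T.1 := by
      rw [vadd_val, mem_translate, sub_neg_eq_add]
    have e2 : (t.1, t.2 + (p + x)) ∈ translate p (R.constituents N k) ↔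
        (t.1, t.2 + x) ∈ R.constituents N k := by
      rw [mem_translate]
      have : t.2 + (p + x) - p = t.2 + x := by abel
      simp only [this]
    rw [e1, ← e2]
    refine hH.mem_iff_of_meets_interior hp ?_
    obtain ⟨y, hyt, hy⟩ := ht
    refine ⟨y + (p + x), ?_, ?_⟩
    · simpa [mem_tileSupport] using hyt
    · rw [interior_tileSupport]
      refine ⟨y + x, closedBall_subset_interior hr hx hxr ?_, ?_⟩
      · simpa [dist_eq_norm] using hy
      · simp only [Homeomorph.coe_addLeft]
        abel
  intro t ht
  rw [key hH hp t ht, key hH' hp' t ht]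

/-- The integrals of `f` over two `N`-supertiles of the same type, possibly in different tilings,
differ little: away from the boundary of the supertile the integrands are close by uniform
continuity, and near it they are bounded. -/
theorem abs_integral_sub_integral_le {f : R.X → ℝ} (hf : Continuous f) {M : ℝ}
    (hM : ∀ T, |f T| ≤ M) {ε η : ℝ} (hε : 0 < ε) (hη : 0 ≤ η)
    (hfε : ∀ T T' : R.X, Close (R.support 0) ε T.1 T'.1 → |f T - f T'| ≤ η)
    {T T' : R.X} {H H' : ∀ N, R.TilingSpace N}
    (hH : IsHierarchy T H) (hH' : IsHierarchy T' H') {N : ℕ} {k : Fin (R.j N)} {p p' : E d}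
    (hp : (k, p) ∈ (H N).1) (hp' : (k, p') ∈ (H' N).1) :
    |(∫ x in tileSupport (R.support N) (k, p), orbitMap f T x) -
        ∫ x in tileSupport (R.support N) (k, p'), orbitMap f T' x| ≤
      η * volume.real (R.support N k) +
        2 * M * volume.real (Metric.cthickening (1 / ε) (frontier (R.support N k))) := by
  have hM0 : 0 ≤ M := (abs_nonneg _).trans (hM T)
  set A := R.support N k with hA
  set B := Metric.cthickening (1 / ε) (frontier A) with hB
  have hAc : IsCompact A := R.isCompact_support N k
  have hBmeas : MeasurableSet B := Metric.isClosed_cthickening.measurableSet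
  have hBfin : volume B ≠ ⊤ := by
    have : Bornology.IsBounded (frontier A) := hAc.isBounded.subset hAc.isClosed.frontier_subset
    exact this.cthickening.measure_lt_top.ne
  have hcont : ∀ (T : R.X) (p : E d), Continuous fun x => orbitMap f T (p + x) := fun T p =>
    (continuous_orbitMap hf T).comp (continuous_const_add p)
  have hint : ∀ (T : R.X) (p : E d), IntegrableOn (fun x => orbitMap f T (p + x)) A :=
    fun T p => integrableOn_of_bounded (hcont T p) (fun x => hM _) hAc.measure_lt_top.ne
  have hg : Continuous fun x => orbitMap f T (p + x) - orbitMap f T' (p' + x) :=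
    (hcont T p).sub (hcont T' p')
  have hg1 : ∀ x, |orbitMap f T (p + x) - orbitMap f T' (p' + x)| ≤ 2 * M := fun x => by
    refine (abs_sub _ _).trans ?_
    linarith [show |orbitMap f T (p + x)| ≤ M from hM _,
      show |orbitMap f T' (p' + x)| ≤ M from hM _]
  have hg2 : ∀ x ∈ A \ B, |orbitMap f T (p + x) - orbitMap f T' (p' + x)| ≤ η := fun x hx =>
    hfε _ _ ⟨0, 0, by simpa using hε.le, by simpa using hε.le, by
      rw [translate_zero, translate_zero]
      exact hH.agreeOnBall hH' hp hp' (by positivity) hx.1 hx.2⟩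
  rw [setIntegral_tileSupport, setIntegral_tileSupport, ← integral_sub (hint T p) (hint T' p'),
    ← integral_inter_add_sdiff hBmeas (integrableOn_of_bounded hg hg1 hAc.measure_lt_top.ne),
    add_comm]
  refine (abs_add_le _ _).trans (add_le_add ?_ ?_)
  · refine (norm_setIntegral_le_of_norm_le_const
      (f := fun x => orbitMap f T (p + x) - orbitMap f T' (p' + x)) (C := η)
      ((measure_mono Set.sdiff_subset).trans_lt hAc.measure_lt_top) hg2).trans ?_
    exact mul_le_mul_of_nonneg_left (measureReal_mono Set.sdiff_subset hAc.measure_lt_top.ne) hη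
  · refine (abs_setIntegral_le hg1 (measure_ne_top_of_subset Set.inter_subset_right hBfin)).trans ?_
    exact mul_le_mul_of_nonneg_left (measureReal_mono Set.inter_subset_right hBfin) (by positivity)

/-- The averages of `f` over the `N`-supertiles of type `k` in the fusion tilings all agree with
`a k` up to an error `θ`. -/
def HasAverages (f : R.X → ℝ) (N : ℕ) (a : Fin (R.j N) → ℝ) (θ : ℝ) : Prop :=
  ∀ (T : R.X) (H : ∀ N, R.TilingSpace N), IsHierarchy T H → ∀ t ∈ (H N).1,
    |(∫ x in tileSupport (R.support N) t, orbitMap f T x) - a t.1 * volume.real (R.support N t.1)| ≤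
      θ * volume.real (R.support N t.1)

theorem exists_close_modulus [CompactSpace R.X] {f : R.X → ℝ} (hf : Continuous f) {η : ℝ}
    (hη : 0 < η) :
    ∃ ε > 0, ∀ T T' : R.X, Close (R.support 0) ε T.1 T'.1 → |f T - f T'| ≤ η := by
  have huc := CompactSpace.uniformContinuous_of_continuous hf
  obtain ⟨ε, hε, h⟩ := ((R.uniformity_hasBasis 0).uniformContinuous_iff
    Metric.uniformity_basis_dist).1 huc η hη
  refine ⟨ε, hε, fun T T' hTT' => ?_⟩
  have := h T T' hTT'
  rw [Set.mem_ofPred_eq, Real.dist_eq] at this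
  exact this.le

/-- At high levels the average of `f` over a supertile nearly depends only on its type. -/
theorem eventually_exists_hasAverages [CompactSpace R.X] (hvh : R.VanHove)
    (hj : ∀ N, Nonempty (Fin (R.j N))) {f : R.X → ℝ} (hf : Continuous f) {M : ℝ}
    (hM : ∀ T, |f T| ≤ M) {θ : ℝ} (hθ : 0 < θ) :
    ∀ᶠ N in atTop, ∃ a, (∀ k, |a k| ≤ |M|) ∧ HasAverages f N a θ := by
  obtain ⟨ε, hε, hfε⟩ := exists_close_modulus hf (half_pos hθ)
  have hη : 0 < θ / (4 * (|M| + 1)) := by positivity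
  filter_upwards [hvh.eventually_le hj (r := 1 / ε) (by positivity) hη] with N hN
  have hex : ∀ k : Fin (R.j N), ∃ c : ℝ, |c| ≤ |M| ∧ ∀ (T : R.X) (H : ∀ N, R.TilingSpace N),
      IsHierarchy T H → ∀ p, (k, p) ∈ (H N).1 →
      |(∫ x in tileSupport (R.support N) (k, p), orbitMap f T x) -
        c * volume.real (R.support N k)| ≤ θ * volume.real (R.support N k) := by
    intro k
    have hV := R.volume_support_pos N k
    -- The average over any one occurrence of the supertile serves; if there is none, so does `0`.
    by_cases hk : ∃ (T : R.X) (H : ∀ N, R.TilingSpace N) (p : E d),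
        IsHierarchy T H ∧ (k, p) ∈ (H N).1
    · obtain ⟨T₀, H₀, p₀, hH₀, hp₀⟩ := hk
      have hM0 : 0 ≤ M := (abs_nonneg _).trans (hM T₀)
      refine ⟨(∫ x in tileSupport (R.support N) (k, p₀), orbitMap f T₀ x) /
        volume.real (R.support N k), ?_, fun T H hH p hp => ?_⟩
      · rw [abs_div, abs_of_pos hV, abs_of_nonneg hM0, div_le_iff₀ hV,
          ← volume_real_tileSupport (S := R.support N) (k, p₀)]
        exact abs_setIntegral_le (fun x => hM _)
          (isCompact_tileSupport (R.isCompact_support N) _).measure_lt_top.ne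
      · rw [div_mul_cancel₀ _ hV.ne']
        refine (abs_integral_sub_integral_le hf hM hε (half_pos hθ).le hfε hH hH₀ hp hp₀).trans ?_
        have h1 : 2 * M * (θ / (4 * (|M| + 1))) ≤ θ / 2 := by
          rw [abs_of_nonneg hM0, mul_div_assoc', div_le_iff₀ (by positivity)]
          nlinarith
        calc _ ≤ θ / 2 * volume.real (R.support N k) +
              2 * M * (θ / (4 * (|M| + 1)) * volume.real (R.support N k)) := by
              gcongr; exact hN k
          _ = (θ / 2 + 2 * M * (θ / (4 * (|M| + 1)))) * volume.real (R.support N k) := by ring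
          _ ≤ _ := mul_le_mul_of_nonneg_right (by linarith) hV.le
    · exact ⟨0, by simp, fun T H hH p hp => absurd ⟨T, H, p, hH, hp⟩ hk⟩
  choose a ha ha' using hex
  exact ⟨a, ha, fun T H hH t ht => ha' t.1 T H hH t.2 ht⟩

theorem sum_fusion_eq (N : ℕ) (l : Fin (R.j (N + 1))) (φ : Fin (R.j N) → ℝ) :
    ∑ t ∈ R.fusion N l, φ t.1 = ∑ k, (R.transition N k l : ℝ) * φ k := by
  rw [← Finset.sum_fiberwise (R.fusion N l) (fun t => t.1)]
  refine Finset.sum_congr rfl fun k _ => ?_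
  rw [Finset.sum_congr rfl fun t ht => by rw [(Finset.mem_filter.1 ht).2], Finset.sum_const,
    nsmul_eq_mul, transition]

theorem tileSupport_succ (N : ℕ) (t : Fin (R.j (N + 1)) × E d) :
    tileSupport (R.support (N + 1)) t =
      patchSupport (R.support N) (translate t.2 (R.fusion N t.1)) := by
  rw [patchSupport_translate, ← R.support_succ, tileSupport_eq_image]

/-- The average over an `(N+1)`-supertile of type `l` is nearly a weighted average of the averages
over the `N`-supertiles, the weights being proportional to the numbers and volumes of the
`N`-supertiles in it. -/
theorem HasAverages.abs_sub_weighted_le {f : R.X → ℝ} (hf : Continuous f) {M : ℝ}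
    (hM : ∀ T, |f T| ≤ M) {N : ℕ} {η θ θ' : ℝ}
    (hη : ∀ k, volume.real (frontier (R.support N k)) ≤ η * volume.real (R.support N k))
    {a : Fin (R.j N) → ℝ} (ha : HasAverages f N a θ) {a' : Fin (R.j (N + 1)) → ℝ}
    (ha' : HasAverages f (N + 1) a' θ') {T : R.X} {H : ∀ N, R.TilingSpace N}
    (hH : IsHierarchy T H) {t : Fin (R.j (N + 1)) × E d} (ht : t ∈ (H (N + 1)).1) :
    |a' t.1 - (∑ k, (R.transition N k t.1 : ℝ) * (a k * volume.real (R.support N k))) /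
      ∑ k, (R.transition N k t.1 : ℝ) * volume.real (R.support N k)| ≤ θ' + (θ + 4 * M * η) := by
  classical
  set Q : Finset (Fin (R.j N) × E d) := (R.fusion N t.1).image fun s => (s.1, t.2 + s.2) with hQ
  have hQset : (Q : Set (Fin (R.j N) × E d)) = translate t.2 (R.fusion N t.1) := by
    rw [hQ, Finset.coe_image, translate]
  have hinj : Set.InjOn (fun s : Fin (R.j N) × E d => (s.1, t.2 + s.2)) (R.fusion N t.1) :=
    fun s _ s' _ h => Prod.ext (Prod.mk.inj h).1 (add_left_cancel (Prod.mk.inj h).2)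
  have hsum : ∀ φ : Fin (R.j N) → ℝ, ∑ s ∈ Q, φ s.1 =
      ∑ k, (R.transition N k t.1 : ℝ) * φ k := fun φ => by
    rw [hQ, Finset.sum_image hinj, sum_fusion_eq]
  have hQH : (Q : Set (Fin (R.j N) × E d)) ⊆ (H N).1 := by
    rw [hQset]
    rintro _ ⟨s, hs, rfl⟩
    exact hH.mem_succ ht hs
  have hQne : Q.Nonempty := (R.fusion_nonempty N t.1).image _
  have h1 := abs_average_patchSupport_sub_le (R.isCompact_support N)
    (R.interior_support_nonempty N) (continuous_orbitMap hf T) (fun x => hM _) hη Q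
    ((H N).2.isTiling.nonOverlapping.mono hQH) hQne a fun s hs => ha T H hH s (hQH hs)
  rw [hQset, ← tileSupport_succ, hsum (fun k => a k * volume.real (R.support N k)),
    hsum (fun k => volume.real (R.support N k)), volume_real_tileSupport] at h1
  refine (abs_sub_le _ _ _).trans (add_le_add ?_ h1)
  have hV := R.volume_support_pos (N + 1) t.1
  have h2 := ha' T H hH t ht
  exact abs_sub_div_le hV h2

/-- One step of the contraction: up to a small error, the averages over `(N+1)`-supertiles oscillate
less than those over `N`-supertiles by the factor `1 - 1 / K`. -/
theorem oscillation_succ_le (hne : Nonempty R.X) (hprim : R.StronglyPrimitive)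
    (hrec : R.Recognizable) {K : ℕ} (hK : ∀ n k l, R.transition n k l ≤ K)
    {f : R.X → ℝ} (hf : Continuous f) {M : ℝ}
    (hM : ∀ T, |f T| ≤ M) {N : ℕ} (hN : 1 ≤ N) {η θ θ' o : ℝ}
    (hη : ∀ k, volume.real (frontier (R.support N k)) ≤ η * volume.real (R.support N k))
    {a : Fin (R.j N) → ℝ} (ha : HasAverages f N a θ) (hao : ∀ k k', |a k - a k'| ≤ o)
    {a' : Fin (R.j (N + 1)) → ℝ} (ha' : HasAverages f (N + 1) a' θ') (l l' : Fin (R.j (N + 1))) :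
    |a' l - a' l'| ≤ (1 - 1 / K) * o + 2 * (θ' + (θ + 4 * M * η)) := by
  have hj := nonempty_type hne hrec N
  obtain ⟨T⟩ := hne
  obtain ⟨H, hH⟩ := hrec.exists_hierarchy T
  obtain ⟨p, hp⟩ := hH.exists_mem hprim (Nat.le_add_left 1 N) l
  obtain ⟨p', hp'⟩ := hH.exists_mem hprim (Nat.le_add_left 1 N) l'
  have h1 := ha.abs_sub_weighted_le hf hM hη ha' hH hp
  have h2 := ha.abs_sub_weighted_le hf hM hη ha' hH hp'
  have hV := R.volume_support_pos N
  have hK0 : (0 : ℝ) < K := by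
    have := (hprim N hN hj.some l).trans_le (hK N hj.some l)
    exact_mod_cast this
  have htr : ∀ l k, (1 : ℝ) ≤ R.transition N k l := fun l k => by exact_mod_cast hprim N hN k l
  have htrK : ∀ l k, (R.transition N k l : ℝ) ≤ K := fun l k => by exact_mod_cast hK N k l
  set W : Fin (R.j (N + 1)) → ℝ := fun l =>
    ∑ k, (R.transition N k l : ℝ) * volume.real (R.support N k) with hW
  set V : ℝ := ∑ k, volume.real (R.support N k) with hVdef
  have hVpos : 0 < V := Finset.sum_pos (fun k _ => hV k) Finset.univ_nonempty
  have hWpos : ∀ l, 0 < W l := fun l => Finset.sum_pos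
    (fun k _ => mul_pos (zero_lt_one.trans_le (htr l k)) (hV k)) Finset.univ_nonempty
  have hWV : ∀ l, W l ≤ K * V := fun l => by
    rw [hW, hVdef, Finset.mul_sum]
    exact Finset.sum_le_sum fun k _ => mul_le_mul_of_nonneg_right (htrK l k) (hV k).le
  have hw1 : ∀ l, ∑ k, (R.transition N k l : ℝ) * volume.real (R.support N k) / W l = 1 :=
    fun l => by rw [← Finset.sum_div, div_self (hWpos l).ne']
  have hwπ : ∀ l k, 1 / (K : ℝ) * (volume.real (R.support N k) / V) ≤
      (R.transition N k l : ℝ) * volume.real (R.support N k) / W l := fun l k => by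
    rw [div_mul_div_comm, one_mul]
    exact div_le_div₀ (mul_nonneg (zero_le_one.trans (htr l k)) (hV k).le)
      (le_mul_of_one_le_left (hV k).le (htr l k)) (hWpos l) (hWV l)
  have h3 := abs_sum_sub_sum_le_of_minorization (a := a) (o := o) (hw1 l) (hw1 l')
    (show ∑ k, volume.real (R.support N k) / V = 1 by
      rw [← Finset.sum_div, div_self hVpos.ne']) (hwπ l) (hwπ l') hao
  have e : ∀ l, (∑ k, (R.transition N k l : ℝ) * (a k * volume.real (R.support N k))) / W l =
      ∑ k, (R.transition N k l : ℝ) * volume.real (R.support N k) / W l * a k := fun l => by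
    rw [Finset.sum_div]
    exact Finset.sum_congr rfl fun k _ => by ring
  change |a' l - (∑ k, (R.transition N k l : ℝ) * (a k * volume.real (R.support N k))) / W l| ≤ _
    at h1
  change |a' l' - (∑ k, (R.transition N k l' : ℝ) * (a k * volume.real (R.support N k))) / W l'| ≤ _
    at h2
  rw [e] at h1 h2
  rw [abs_le] at h1 h2 h3 ⊢
  constructor <;> linarith [h1.1, h1.2, h2.1, h2.2, h3.1, h3.2]

/-- At a high level the averages of `f` over all supertiles in all fusion tilings nearly agree:
passing from one level to the next contracts the oscillation of the averages by a fixed factor, as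
the entries of the transition matrices lie between `1` and `K`. -/
theorem exists_hasAverages_const [CompactSpace R.X] (hne : Nonempty R.X)
    (hprim : R.StronglyPrimitive) (hvh : R.VanHove) (hrec : R.Recognizable)
    (hbdd : ∃ K : ℕ, ∀ n k l, R.transition n k l ≤ K)
    {f : R.X → ℝ} (hf : Continuous f) {M : ℝ} (hM : ∀ T, |f T| ≤ M) {δ : ℝ} (hδ : 0 < δ) :
    ∃ (N : ℕ) (c : ℝ), HasAverages f N (fun _ => c) δ ∧
      ∀ k, volume.real (frontier (R.support N k)) ≤ δ * volume.real (R.support N k) := by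
  have hj := nonempty_type hne hrec
  have hM0 : 0 ≤ M := (abs_nonneg _).trans (hM hne.some)
  obtain ⟨K, hK⟩ := hbdd
  have hK1 : (1 : ℝ) ≤ K := by
    exact_mod_cast (hprim 1 le_rfl (hj 1).some (hj 2).some).trans_le (hK 1 _ _)
  have hK0 : (0 : ℝ) < K := by linarith
  -- With errors `ζ` at each level a single step costs `(4 + 8 * M) * ζ`. The geometric series with
  -- ratio `1 - 1 / K` multiplies this by `K`, and `ζ` is chosen so that the total is `δ / 4`.
  set ζ : ℝ := δ / (4 * K * (4 + 8 * M)) with hζ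
  have hζ0 : 0 < ζ := by positivity
  have hζK : (4 + 8 * M) * ζ * K = δ / 4 := by
    rw [hζ]; field_simp
  have hζδ : ζ ≤ δ / 4 := by
    rw [← hζK]
    have : 1 ≤ (4 + 8 * M) * K := by nlinarith
    nlinarith
  have hev := (hvh.eventually_le hj le_rfl hζ0).and
    (eventually_exists_hasAverages hvh hj hf hM hζ0)
  obtain ⟨N₀, hN₀⟩ := (hev.and (eventually_ge_atTop 1)).exists_forall_of_atTop
  have hfr : ∀ N, N₀ ≤ N → ∀ k,
      volume.real (frontier (R.support N k)) ≤ ζ * volume.real (R.support N k) := by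
    intro N hN k
    have := (hN₀ N hN).1.1 k
    rwa [Metric.cthickening_zero, isClosed_frontier.closure_eq] at this
  set q : ℝ := 1 - 1 / K with hq
  have hq0 : 0 ≤ q := by
    rw [hq, sub_nonneg, div_le_one hK0]; exact hK1
  have hq1 : q < 1 := by
    rw [hq]; linarith [show (0 : ℝ) < 1 / K by positivity]
  have key : ∀ m, ∃ a, HasAverages f (N₀ + m) a ζ ∧
      ∀ k k', |a k - a k'| ≤ q ^ m * (2 * M) + (4 + 8 * M) * ζ * K := by
    intro m
    induction m with
    | zero =>
      obtain ⟨a, haM, ha⟩ := (hN₀ N₀ le_rfl).1.2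
      refine ⟨a, ha, fun k k' => (abs_sub _ _).trans ?_⟩
      rw [abs_of_nonneg hM0] at haM
      have : 0 ≤ (4 + 8 * M) * ζ * K := by positivity
      linarith [haM k, haM k']
    | succ m ih =>
      obtain ⟨a, ha, hao⟩ := ih
      obtain ⟨a', -, ha'⟩ := (hN₀ (N₀ + (m + 1)) (by omega)).1.2
      refine ⟨a', ha', fun k k' => ?_⟩
      have := oscillation_succ_le hne hprim hrec hK hf hM
        (by have := (hN₀ N₀ le_rfl).2; omega) (hfr (N₀ + m) (by omega)) ha hao ha' k k'
      refine this.trans_eq ?_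
      rw [← hq, pow_succ]
      have : q * K = K - 1 := by rw [hq]; field_simp
      linear_combination (4 + 8 * M) * ζ * this
  have hlim : Tendsto (fun m => q ^ m * (2 * M)) atTop (𝓝 0) := by
    simpa using (tendsto_pow_atTop_nhds_zero_of_lt_one hq0 hq1).mul_const (2 * M)
  obtain ⟨m, hm⟩ := (hlim.eventually_lt_const (show 0 < δ / 4 by positivity)).exists
  obtain ⟨a, ha, hao⟩ := key m
  refine ⟨N₀ + m, a (hj _).some, fun T H hH t ht => ?_, fun k => ?_⟩
  · have hV := R.volume_support_pos (N₀ + m) t.1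
    have h1 := ha T H hH t ht
    have h2 : |a t.1 * volume.real (R.support (N₀ + m) t.1) -
        a (hj _).some * volume.real (R.support (N₀ + m) t.1)| ≤
        δ / 2 * volume.real (R.support (N₀ + m) t.1) := by
      rw [← sub_mul, abs_mul, abs_of_pos hV]
      exact mul_le_mul_of_nonneg_right (by linarith [hao t.1 (hj _).some]) hV.le
    refine (abs_sub_le _ _ _).trans ((add_le_add h1 h2).trans ?_)
    rw [← add_mul]
    exact mul_le_mul_of_nonneg_right (by linarith) hV.le
  · exact (hfr _ (by omega) k).trans (mul_le_mul_of_nonneg_right (by linarith)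
      (R.volume_support_pos _ k).le)

/-! ### Uniform convergence of ball averages -/

/-- The average of `f` over the translates of `T` by the vectors in a ball of radius `r`. -/
noncomputable def ballAverage (f : R.X → ℝ) (r : ℝ) (T : R.X) : ℝ :=
  (∫ x in Metric.closedBall 0 r, orbitMap f T x) / volume.real (Metric.closedBall (0 : E d) r)

theorem eventually_volume_closedBall_add_le (d : ℕ) (C : ℝ) (hC : 0 ≤ C) {κ : ℝ} (hκ : 0 < κ) :
    ∀ᶠ r in atTop, volume.real (Metric.closedBall (0 : E d) (r + C)) ≤
      (1 + κ) * volume.real (Metric.closedBall (0 : E d) r) := by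
  have h : Tendsto (fun r : ℝ => (1 + C / r) ^ d) atTop (𝓝 1) := by
    have := ((tendsto_const_nhds (x := C)).div_atTop tendsto_id).const_add 1
    simpa using this.pow d
  filter_upwards [h.eventually_le_const (show (1 : ℝ) < 1 + κ by linarith), eventually_gt_atTop 0]
    with r hr hr0
  rw [measureReal_def, measureReal_def, Measure.addHaar_closedBall _ _ (by positivity),
    Measure.addHaar_closedBall _ _ hr0.le, ENNReal.toReal_mul, ENNReal.toReal_mul,
    ENNReal.toReal_ofReal (by positivity), ENNReal.toReal_ofReal (by positivity),
    finrank_euclideanSpace_fin, ← mul_assoc]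
  refine mul_le_mul_of_nonneg_right ?_ ENNReal.toReal_nonneg
  have : (r + C) ^ d = (1 + C / r) ^ d * r ^ d := by
    rw [← mul_pow]; congr 1; field_simp
  rw [this]
  exact mul_le_mul_of_nonneg_right hr (by positivity)

/-- A large ball is covered by the supertiles of a high level that meet it, and these fill little
more than the ball; hence its average is near the common average of the supertiles. -/
theorem exists_ballAverage_near [CompactSpace R.X] (hne : Nonempty R.X)
    (hprim : R.StronglyPrimitive) (hvh : R.VanHove) (hrec : R.Recognizable)
    (hbdd : ∃ K : ℕ, ∀ n k l, R.transition n k l ≤ K)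
    {f : R.X → ℝ} (hf : Continuous f) {M : ℝ} (hM : ∀ T, |f T| ≤ M) {δ : ℝ} (hδ : 0 < δ) :
    ∃ c : ℝ, ∀ᶠ r in atTop, ∀ T : R.X, |ballAverage f r T - c| ≤ δ := by
  have hM0 : 0 ≤ M := (abs_nonneg _).trans (hM hne.some)
  -- The supertiles contribute an error `κ + 4 * M * κ`, the excess over the ball `2 * M * κ`.
  set κ := δ / (2 * (1 + 4 * M)) with hκ
  have hκ0 : 0 < κ := by positivity
  have hκδ : κ + 4 * M * κ = δ / 2 := by rw [hκ]; field_simp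
  obtain ⟨N, c, hc, hfr⟩ := exists_hasAverages_const hne hprim hvh hrec hbdd hf hM hκ0
  obtain ⟨D, hD0, hD⟩ := exists_bound (R.isCompact_support N)
  refine ⟨c, ?_⟩
  filter_upwards [eventually_volume_closedBall_add_le d (2 * D) (by positivity) hκ0,
    eventually_gt_atTop 0] with r hr hr0 T
  obtain ⟨H, hH⟩ := hrec.exists_hierarchy T
  have hTil := (H N).2.isTiling
  have hfin := tilesMeeting_finite (R.isCompact_support N) (R.interior_support_nonempty N)
    hTil.nonOverlapping r
  set Q := hfin.toFinset with hQ
  have hQset : (Q : Set (Fin (R.j N) × E d)) = tilesMeeting (R.support N) r (H N).1 := by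
    simp [hQ]
  have hQH : (Q : Set (Fin (R.j N) × E d)) ⊆ (H N).1 := by
    rw [hQset]; exact fun t ht => ht.1
  have hQne : Q.Nonempty := by
    obtain ⟨t, ht, h0⟩ := hTil.exists_mem 0
    exact ⟨t, by rw [hQ, Set.Finite.mem_toFinset]; exact ⟨ht, 0, h0, by simpa using hr0.le⟩⟩
  set U := patchSupport (R.support N) (Q : Set (Fin (R.j N) × E d)) with hU
  have hUc : IsCompact U :=
    Q.finite_toSet.isCompact_biUnion fun t _ => isCompact_tileSupport (R.isCompact_support N) t
  set B := Metric.closedBall (0 : E d) r with hB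
  have hBU : B ⊆ U := fun x hx => by
    obtain ⟨t, ht, hxt⟩ := hTil.exists_mem x
    have : t ∈ (Q : Set (Fin (R.j N) × E d)) := by rw [hQset]; exact ⟨ht, x, hxt, hx⟩
    exact Set.mem_biUnion this hxt
  have hUB : U ⊆ Metric.closedBall 0 (r + 2 * D) := by
    rw [hU, hQset]
    refine Set.iUnion₂_subset fun t ht x hx => ?_
    obtain ⟨y, hyt, hy⟩ := ht.2
    rw [mem_closedBall_zero_iff] at hy ⊢
    have e1 := hD t x hx
    have e2 := hD t y hyt
    have : x = y + (x - t.2) - (y - t.2) := by abel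
    rw [this]
    linarith [norm_sub_le (y + (x - t.2)) (y - t.2), norm_add_le y (x - t.2)]
  have hBpos : 0 < volume.real B := ENNReal.toReal_pos
    (Metric.measure_closedBall_pos volume _ hr0).ne' measure_closedBall_lt_top.ne
  have hBU' : volume.real B ≤ volume.real U := measureReal_mono hBU hUc.measure_lt_top.ne
  have hdiff : volume.real (U \ B) = volume.real U - volume.real B :=
    measureReal_sdiff hBU Metric.isClosed_closedBall.measurableSet hUc.measure_lt_top.ne
  have hvol : volume.real U - volume.real B ≤ κ * volume.real B := by
    have := measureReal_mono (μ := volume) hUB measure_closedBall_lt_top.ne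
    linarith
  have h1 := abs_average_patchSupport_sub_le (R.isCompact_support N)
    (R.interior_support_nonempty N) (continuous_orbitMap hf T) (fun x => hM _) hfr Q
    (hTil.nonOverlapping.mono hQH) hQne (fun _ => c) fun s hs => hc T H hH s (hQH hs)
  rw [← Finset.mul_sum, mul_div_cancel_right₀ _ (Finset.sum_pos
    (fun t _ => R.volume_support_pos N t.1) hQne).ne'] at h1
  have h2 := abs_div_sub_div_le (I := ∫ x in U, orbitMap f T x) (J := ∫ x in B, orbitMap f T x)
    (a := M * κ) (b := κ) (hBpos.trans_le hBU') hBpos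
    (abs_setIntegral_le (fun x => hM _) hUc.measure_lt_top.ne) (by
      refine (abs_setIntegral_sub_le (continuous_orbitMap hf T) (fun x => hM _) hBU
        Metric.isClosed_closedBall.measurableSet hUc.measure_lt_top.ne).trans ?_
      rw [hdiff, mul_assoc]
      exact mul_le_mul_of_nonneg_left hvol hM0) (by
      rwa [abs_of_nonneg (by linarith)])
  rw [abs_sub_comm] at h2
  refine (abs_sub_le _ ((∫ x in U, orbitMap f T x) / volume.real U) _).trans
    ((add_le_add h2 h1).trans ?_)
  nlinarith

/-- The ball averages of a continuous function converge uniformly to a constant. -/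
theorem exists_tendstoUniformly_ballAverage [CompactSpace R.X] (hne : Nonempty R.X)
    (hprim : R.StronglyPrimitive) (hvh : R.VanHove) (hrec : R.Recognizable)
    (hbdd : ∃ K : ℕ, ∀ n k l, R.transition n k l ≤ K) {f : R.X → ℝ} (hf : Continuous f) :
    ∃ c : ℝ, TendstoUniformly (ballAverage f) (fun _ => c) atTop := by
  obtain ⟨M, hM⟩ := isCompact_univ.exists_bound_of_continuousOn hf.continuousOn
  have hM' : ∀ T, |f T| ≤ M := fun T => hM T trivial
  have hnear := fun (δ : ℝ) (hδ : 0 < δ) =>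
    exists_ballAverage_near hne hprim hvh hrec hbdd hf hM' hδ
  obtain ⟨T₀⟩ := hne
  have hcauchy : Cauchy (map (fun r => ballAverage f r T₀) atTop) := by
    refine Metric.cauchy_iff.2 ⟨inferInstance, fun ε hε => ?_⟩
    obtain ⟨c, hc⟩ := hnear (ε / 3) (by positivity)
    refine ⟨Metric.closedBall c (ε / 3), ?_, fun x hx y hy => ?_⟩
    · exact Filter.mem_map.2 (hc.mono fun r hr => hr T₀)
    · rw [Metric.mem_closedBall] at hx hy
      linarith [dist_triangle_right x y c]
  obtain ⟨c, hc⟩ := cauchy_map_iff_exists_tendsto.1 hcauchy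
  refine ⟨c, Metric.tendstoUniformly_iff.2 fun ε hε => ?_⟩
  obtain ⟨c', hc'⟩ := hnear (ε / 3) (by positivity)
  have hcc' : dist c c' ≤ ε / 3 :=
    le_of_tendsto (hc.dist tendsto_const_nhds) (hc'.mono fun r hr => hr T₀)
  filter_upwards [hc'] with r hr T
  have : dist (ballAverage f r T) c' ≤ ε / 3 := hr T
  linarith [dist_triangle_right c (ballAverage f r T) c']

end FusionRule

/-! ### Invariant measures -/

/-- If there is only one invariant probability measure, it is ergodic: otherwise conditioning on
an invariant set would give a second one. -/
theorem uniquelyErgodic_of_unique {G X : Type} [AddGroup G] [AddAction G X] [MeasurableSpace X]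
    [MeasurableConstVAdd G X] (μ : Measure X) [IsProbabilityMeasure μ]
    [VAddInvariantMeasure G X μ]
    (h : ∀ ν : Measure X, IsProbabilityMeasure ν → VAddInvariantMeasure G X ν → ν = μ) :
    UniquelyErgodic G X := by
  refine ⟨μ, inferInstance, ⟨fun {s} hs hinv => ?_⟩, h⟩
  rw [eventuallyConst_set']
  by_cases h0 : μ s = 0
  · exact Or.inl (ae_eq_empty.2 h0)
  right
  have hprob : IsProbabilityMeasure (ProbabilityTheory.cond μ s) :=
    ProbabilityTheory.cond_isProbabilityMeasure h0
  have hcond := h (ProbabilityTheory.cond μ s) hprob ⟨fun g B hB => by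
    rw [ProbabilityTheory.cond_apply hs, ProbabilityTheory.cond_apply hs]
    congr 1
    calc μ (s ∩ (g +ᵥ ·) ⁻¹' B) = μ ((g +ᵥ ·) ⁻¹' s ∩ (g +ᵥ ·) ⁻¹' B) :=
          measure_congr ((hinv g).symm.inter (ae_eq_refl _))
      _ = μ (s ∩ B) := VAddInvariantMeasure.measure_preimage_vadd g (hs.inter hB)⟩
  refine ae_eq_univ.2 ?_
  rw [← hcond, ProbabilityTheory.cond_apply hs, Set.inter_compl_self, measure_empty, mul_zero]

namespace FusionRule

variable {d : ℕ} {R : FusionRule d}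

theorem integrable_orbitMap_prod {f : R.X → ℝ} (hf : Continuous f) {M : ℝ} (hM : ∀ T, |f T| ≤ M)
    (ν : Measure R.X) [IsProbabilityMeasure ν] (r : ℝ) :
    Integrable (Function.uncurry fun (T : R.X) (x : E d) => orbitMap f T x)
      (ν.prod (volume.restrict (Metric.closedBall (0 : E d) r))) := by
  have : IsFiniteMeasure (volume.restrict (Metric.closedBall (0 : E d) r)) :=
    ⟨by rw [Measure.restrict_apply_univ]; exact measure_closedBall_lt_top⟩
  have hcont : Continuous (Function.uncurry fun (T : R.X) (x : E d) => orbitMap f T x) :=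
    hf.comp (continuous_snd.neg.vadd continuous_fst)
  exact Integrable.of_bound hcont.aestronglyMeasurable M (Eventually.of_forall fun q => hM _)

/-- By Fubini's theorem, replacing a function by its ball averages does not change its integral
against an invariant measure. -/
theorem integral_ballAverage {f : R.X → ℝ} (hf : Continuous f) {M : ℝ} (hM : ∀ T, |f T| ≤ M)
    (ν : Measure R.X) [IsProbabilityMeasure ν] [VAddInvariantMeasure (E d) R.X ν] {r : ℝ}
    (hr : 0 < r) : ∫ T, ballAverage f r T ∂ν = ∫ T, f T ∂ν := by
  have hB : 0 < volume.real (Metric.closedBall (0 : E d) r) := ENNReal.toReal_pos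
    (Metric.measure_closedBall_pos volume _ hr).ne' measure_closedBall_lt_top.ne
  have hinv : ∀ x : E d, ∫ T, orbitMap f T x ∂ν = ∫ T, f T ∂ν := fun x =>
    integral_vadd_eq_self f (g := -x)
  simp only [ballAverage]
  rw [integral_div, integral_integral_swap (integrable_orbitMap_prod hf hM ν r)]
  simp only [hinv]
  rw [setIntegral_const, smul_eq_mul, mul_div_cancel_left₀ _ hB.ne']

theorem integral_eq_of_tendstoUniformly {f : R.X → ℝ} (hf : Continuous f) {M : ℝ}
    (hM : ∀ T, |f T| ≤ M) {c : ℝ} (hc : TendstoUniformly (ballAverage f) (fun _ => c) atTop)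
    (ν : Measure R.X) [IsProbabilityMeasure ν] [VAddInvariantMeasure (E d) R.X ν] :
    ∫ T, f T ∂ν = c := by
  refine eq_of_forall_dist_le fun ε hε => ?_
  obtain ⟨r, hr, hr0⟩ := ((Metric.tendstoUniformly_iff.1 hc ε hε).and
    (eventually_gt_atTop 0)).exists
  have hint : Integrable (ballAverage f r) ν :=
    ((integrable_orbitMap_prod hf hM ν r).integral_prod_left).div_const _
  rw [← integral_ballAverage hf hM ν hr0, Real.dist_eq]
  have h1 : (∫ T, ballAverage f r T ∂ν) - c = ∫ T, (ballAverage f r T - c) ∂ν := by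
    rw [integral_sub hint (integrable_const c)]
    simp
  rw [h1]
  have := norm_integral_le_of_norm_le_const (μ := ν) (f := fun T => ballAverage f r T - c) (C := ε)
    (Eventually.of_forall fun T => by
      rw [← dist_eq_norm, dist_comm]; exact (hr T).le)
  simpa using this

/-- The empirical measure of the orbit of `T` over a ball. -/
noncomputable def empiricalMeasure (T : R.X) (r : ℝ) : Measure R.X :=
  (ProbabilityTheory.cond volume (Metric.closedBall (0 : E d) r)).map fun x : E d => -x +ᵥ T

theorem continuous_neg_vadd (T : R.X) : Continuous fun x : E d => -x +ᵥ T :=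
  continuous_neg.vadd continuous_const

theorem isProbabilityMeasure_empiricalMeasure (T : R.X) {r : ℝ} (hr : 0 < r) :
    IsProbabilityMeasure (empiricalMeasure T r) := by
  have := ProbabilityTheory.cond_isProbabilityMeasure_of_finite (μ := volume)
    (s := Metric.closedBall (0 : E d) r) (Metric.measure_closedBall_pos volume _ hr).ne'
    measure_closedBall_lt_top.ne
  exact Measure.isProbabilityMeasure_map (continuous_neg_vadd T).aemeasurable

theorem integral_empiricalMeasure {f : R.X → ℝ} (hf : Continuous f) (T : R.X) (r : ℝ) :
    ∫ T', f T' ∂(empiricalMeasure T r) = ballAverage f r T := by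
  rw [empiricalMeasure, integral_map (continuous_neg_vadd T).aemeasurable
    hf.aestronglyMeasurable, ProbabilityTheory.cond, integral_smul_measure, ENNReal.toReal_inv,
    ballAverage, smul_eq_mul, div_eq_inv_mul]
  rfl

/-- Any weak limit of empirical measures integrates a function to the limit of its ball
averages. -/
theorem exists_measure_integral_eq [CompactSpace R.X] (T : R.X) :
    ∃ μ : Measure R.X, IsProbabilityMeasure μ ∧ ∀ f : R.X → ℝ, Continuous f → ∀ c,
      Tendsto (fun r => ballAverage f r T) atTop (𝓝 c) → ∫ T', f T' ∂μ = c := by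
  set μs : ℕ → ProbabilityMeasure R.X := fun n =>
    ⟨empiricalMeasure T (n + 1), isProbabilityMeasure_empiricalMeasure T (by positivity)⟩
  obtain ⟨μ, -, hμ⟩ := isCompact_univ.ultrafilter_le_nhds
    ((Ultrafilter.of (atTop : Filter ℕ)).map μs) (by simp)
  refine ⟨μ, inferInstance, fun f hf c hc => ?_⟩
  have hlim : Tendsto μs (Ultrafilter.of (atTop : Filter ℕ)) (𝓝 μ) := hμ
  have h1 := ProbabilityMeasure.tendsto_iff_forall_integral_tendsto.1 hlim
    (BoundedContinuousFunction.mkOfCompact ⟨f, hf⟩)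
  have h2 : Tendsto (fun n : ℕ => ballAverage f (n + 1) T)
      (Ultrafilter.of (atTop : Filter ℕ)) (𝓝 c) :=
    (hc.comp (tendsto_atTop_add_const_right _ 1 tendsto_natCast_atTop_atTop)).mono_left
      (Ultrafilter.of_le _)
  refine tendsto_nhds_unique h1 (h2.congr fun n => ?_)
  exact (integral_empiricalMeasure hf T _).symm

theorem ballAverage_comp_vadd (f : R.X → ℝ) (v : E d) (r : ℝ) (T : R.X) :
    ballAverage (fun T => f (v +ᵥ T)) r T = ballAverage f r (v +ᵥ T) := by
  simp only [ballAverage, orbitMap, vadd_vadd, add_comm v]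

theorem uniquelyErgodic (hne : Nonempty R.X) (hflc : ∀ T : R.X, IsFLC (R.support 0) T.1)
    (hprim : R.StronglyPrimitive) (hvh : R.VanHove) (hrec : R.Recognizable)
    (hbdd : ∃ K : ℕ, ∀ n k l, R.transition n k l ≤ K) : UniquelyErgodic (E d) R.X := by
  have hcomp : CompactSpace R.X := compactSpace hne hflc hprim hrec
  have hlim : ∀ f : BoundedContinuousFunction R.X ℝ,
      ∃ c : ℝ, TendstoUniformly (ballAverage f) (fun _ => c) atTop := fun f =>
    exists_tendstoUniformly_ballAverage hne hprim hvh hrec hbdd f.continuous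
  obtain ⟨T₀⟩ := hne
  obtain ⟨μ, hμ, hμf⟩ := exists_measure_integral_eq T₀
  have hinv : VAddInvariantMeasure (E d) R.X μ := by
    refine ⟨fun v s hs => ?_⟩
    have hv : Continuous fun T : R.X => v +ᵥ T := continuous_const_vadd v
    have : IsProbabilityMeasure (μ.map fun T => v +ᵥ T) :=
      Measure.isProbabilityMeasure_map hv.aemeasurable
    have hmap : μ.map (fun T => v +ᵥ T) = μ := by
      refine ext_of_forall_integral_eq_of_IsFiniteMeasure fun f => ?_
      obtain ⟨c, hc⟩ := hlim f
      rw [integral_map hv.aemeasurable f.continuous.aestronglyMeasurable,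
        hμf f f.continuous c (hc.tendsto_at T₀)]
      refine hμf _ (f.continuous.comp hv) c ?_
      simp only [Function.comp_def, ballAverage_comp_vadd]
      exact hc.tendsto_at (v +ᵥ T₀)
    rw [← Measure.map_apply hv.measurable hs, hmap]
  refine uniquelyErgodic_of_unique μ fun ν hν hνinv =>
    ext_of_forall_integral_eq_of_IsFiniteMeasure fun f => ?_
  obtain ⟨c, hc⟩ := hlim f
  rw [hμf f f.continuous c (hc.tendsto_at T₀)]
  exact integral_eq_of_tendstoUniformly f.continuous f.norm_coe_le_norm hc ν

end FusionRule

end FusionTiling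

theorem mainTheorem5 (d : ℕ) (hd : 1 ≤ d) (R : FusionTiling.FusionRule d)
    (hne : Nonempty R.X)
    (hflc : ∀ T : R.X, FusionTiling.IsFLC (R.support 0) T.1)
    (hprim : R.StronglyPrimitive) (hvh : R.VanHove) (hrec : R.Recognizable)
    (hbdd : ∃ K : ℕ, ∀ n k l, R.transition n k l ≤ K) :
    FusionTiling.UniquelyErgodic (FusionTiling.E d) R.X :=
  FusionTiling.FusionRule.uniquelyErgodic hne hflc hprim hvh hrec hbdd
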